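/- Let $k$ be a field, let $\mathbb G$ be $\mathbb Z$ or $\mathbb Z/2$ (more generally, any abelian group with a distinguished element $1$ and a parity homomorphism $\mathbb G\to\mathbb Z/2$, $1\mapsto 1$), and let $\mathcal A$ be a differential $\mathbb G$-graded $k$-category. Let $P,N$ be objects of $\mathcal A$ such that $P$ is a direct summand of $N$: there are closed morphisms $i:P\to N$ and $j:N\to P$ of degree $0$ with $j\circ i=1_P$. Put $\pi:=i\circ j\in\operatorname{End}(N)$, and let $\{P,N\}$ be the full dg subcategory of $\mathcal A$ on the objects $P$ and $N$. Let $(\overline C\{P,N\},b,B)$ be the normalized mixed Hochschild complex of $\{P,N\}$. It is spanned by the words $a_0[a_1|\cdots|a_n]$, $n\ge 0$, of homogeneous cyclically composable morphisms, $k$-linear in each letter, of degree $|a_0|+\sum_{l\ge1}(|a_l|-1)$, and words with $a_l$ an identity for some $l\ge 1$ are zero. Here $$\begin{aligned} b(a_0[a_1|\cdots|a_n])={}&(da_0)[a_1|\cdots|a_n]+\sum_{l=1}^{n}(-1)^{|a_0|+\cdots+|a_{l-1}|-l}\,a_0[a_1|\cdots|da_l|\cdots|a_n]\\ &+(-1)^{|a_0|}a_0a_1[a_2|\cdots|a_n]+\sum_{l=1}^{n-1}(-1)^{|a_0|+\cdots+|a_l|-l}\,a_0[a_1|\cdots|a_la_{l+1}|\cdots|a_n]\\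 &-(-1)^{(|a_n|-1)(|a_0|+\cdots+|a_{n-1}|-(n-1))}\,a_na_0[a_1|\cdots|a_{n-1}]\end{aligned}$$ (the terms that involve $a_1$ or $a_n$ outside their range, for $n=0$, are absent), and $B$ is Connes' operator, which sends $a_0[a_1|\cdots|a_n]$ to the sum of the words $1[a_l|\cdots|a_n|a_0|\cdots|a_{l-1}]$ over the $n+1$ cyclic rotations, $1$ being the identity of the codomain of the letter that follows it, with sign $(-1)^{(|a_0|+\cdots+|a_{l-1}|-l)(|a_l|+\cdots+|a_n|-(n-l+1))}$. Let $u$ be a variable of degree $2$; $(\overline C\{P,N\}[[u]],\,b+uB)$ is the normalized negative cyclic complex. Then $1_P$ and $$\eta_\pi:=\pi+\sum_{i\ge1}(-1)^i\,\frac{(2i)!}{2\,(i!)}\,(2\pi-1_N)[\underbrace{\pi|\cdots|\pi}_{2i}]\,u^i$$ (the coefficients $(2i)!/(2\,(i!))$ are integers) are cycles of degree $0$ in $(\overline C\{P,N\}[[u]],\,b+uB)$, and they are homologous there: there is an element $w$ of degree $-1$ with $(b+uB)(w)=1_P-\eta_\pi$. -/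

import Mathlib

universe u v w w'

/-- A grading group: an abelian group `G` with a distinguished element `1` (the degree of a
differential) and a parity `G → ℤ/2` with `1 ↦ 1`. The two standard cases `G = ℤ` and
`G = ℤ/2` are given by the instances below. -/
class GradingParity (G : Type w) [AddCommGroupWithOne G] where
  parity : G →+ ZMod 2
  parity_one : parity 1 = 1

instance : GradingParity ℤ where
  parity := (Int.castRingHom (ZMod 2)).toAddMonoidHom
  parity_one := by simp

instance : GradingParity (ZMod 2) where
  parity := AddMonoidHom.id _
  parity_one := rfl

/-- A (small) differential `G`-graded category over `k`. The morphisms `x → y` are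
`Hom x y = ⨁ g, grade x y g`, and `comp f g` is `f ∘ g`. -/
structure DGCategory (k : Type w') [CommRing k] (G : Type w) [AddCommGroupWithOne G]
    [GradingParity G] where
  Obj : Type u
  Hom : Obj → Obj → Type v
  [addCommGroup : ∀ x y, AddCommGroup (Hom x y)]
  [module : ∀ x y, Module k (Hom x y)]
  grade : ∀ x y, G → Submodule k (Hom x y)
  grade_isInternal : ∀ x y, letI := Classical.decEq G; DirectSum.IsInternal (grade x y)
  d : ∀ x y, Hom x y →ₗ[k] Hom x y
  comp : ∀ {x y z}, Hom y z →ₗ[k] Hom x y →ₗ[k] Hom x z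
  one : ∀ x, Hom x x
  comp_assoc : ∀ {w x y z} (f : Hom y z) (g : Hom x y) (h : Hom w x),
    comp (comp f g) h = comp f (comp g h)
  one_comp : ∀ {x y} (f : Hom x y), comp (one y) f = f
  comp_one : ∀ {x y} (f : Hom x y), comp f (one x) = f
  one_mem : ∀ x, one x ∈ grade x x 0
  comp_mem : ∀ {x y z g h} {f : Hom y z} {f' : Hom x y},
    f ∈ grade y z g → f' ∈ grade x y h → comp f f' ∈ grade x z (g + h)
  d_mem : ∀ {x y g} {f : Hom x y}, f ∈ grade x y g → d x y f ∈ grade x y (g + 1)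
  d_d : ∀ {x y} (f : Hom x y), d x y (d x y f) = 0
  d_comp : ∀ {x y z g} {f : Hom y z} (_ : f ∈ grade y z g) (f' : Hom x y),
    d x z (comp f f') = comp (d y z f) f' +
      (if GradingParity.parity g = 0 then (1 : k) else -1) • comp f (d x y f')

namespace DGCategory

attribute [instance] DGCategory.addCommGroup DGCategory.module

variable {k : Type w'} [CommRing k] {G : Type w} [AddCommGroupWithOne G] [GradingParity G]

/-- The full dg subcategory on a set of objects. -/
def full (A : DGCategory.{u, v} k G) (S : Set A.Obj) : DGCategory.{u, v} k G where
  Obj := S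
  Hom x y := A.Hom x y
  grade x y := A.grade x y
  grade_isInternal x y := A.grade_isInternal x y
  d x y := A.d x y
  comp := A.comp
  one x := A.one x
  comp_assoc := A.comp_assoc
  one_comp := A.one_comp
  comp_one := A.comp_one
  one_mem x := A.one_mem x
  comp_mem := A.comp_mem
  d_mem := A.d_mem
  d_d := A.d_d
  d_comp := A.d_comp

variable (A : DGCategory.{u, v} k G)

/-- The sign `(-1) ^ p`. -/
def sgn (k : Type w') [CommRing k] (p : ZMod 2) : k := if p = 0 then 1 else -1

/-- The parity of a degree. -/
abbrev par (g : G) : ZMod 2 := GradingParity.parity g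

section homogeneous

/-- Composition of homogeneous morphisms. -/
def hcomp {x y z : A.Obj} {g h : G} (a : A.grade y z g) (b : A.grade x y h) :
    A.grade x z (g + h) := ⟨A.comp (a : A.Hom y z) (b : A.Hom x y), A.comp_mem a.2 b.2⟩

/-- Differential of a homogeneous morphism. -/
def hd {x y : A.Obj} {g : G} (a : A.grade x y g) : A.grade x y (g + 1) :=
  ⟨A.d x y a, A.d_mem a.2⟩

/-- The identity as a homogeneous morphism. -/
def hone (x : A.Obj) : A.grade x x (0 : G) := ⟨A.one x, A.one_mem x⟩

end homogeneous

/-- `BarWord t s`: words `[a₁|…|aₙ]` of homogeneous morphisms for which the composite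
`a₁ ∘ ⋯ ∘ aₙ : s → t` makes sense. -/
inductive BarWord : A.Obj → A.Obj → Type (max u v w)
  | nil {x : A.Obj} : BarWord x x
  | cons {t y s : A.Obj} {g : G} (a : A.grade y t g) (p : BarWord y s) : BarWord t s

namespace BarWord

variable {A}

/-- Concatenation of words. -/
def append : ∀ {t y s : A.Obj}, BarWord A t y → BarWord A y s → BarWord A t s
  | _, _, _, nil, r => r
  | _, _, _, cons a p, r => cons a (append p r)

/-- The degree `|a₁| - 1 + ⋯ + |aₙ| - 1`. -/
def deg : ∀ {t s : A.Obj}, BarWord A t s → G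
  | _, _, nil => 0
  | _, _, cons (g := g) _ p => g - 1 + deg p

/-- All the ways to write a word as a concatenation `q ++ r`. -/
def splits : ∀ {t s : A.Obj}, BarWord A t s → List (Σ y, BarWord A t y × BarWord A y s)
  | t, _, nil => [⟨t, nil, nil⟩]
  | t, _, cons a p =>
      ⟨t, nil, cons a p⟩ :: (splits p).map fun z => ⟨z.1, cons a z.2.1, z.2.2⟩

/-- The word `[a|…|a]` with `n` letters. -/
def rep {x : A.Obj} {g : G} (a : A.grade x x g) : ℕ → BarWord A x x
  | 0 => nil
  | n + 1 => cons a (rep a n)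

end BarWord

/-- Cyclically composable words `a₀[a₁|…|aₙ]` of homogeneous morphisms, `n ≥ 0`. -/
structure HWord where
  {cod : A.Obj}
  {dom : A.Obj}
  {g : G}
  head : A.grade dom cod g
  tail : BarWord A dom cod

namespace HWord

variable {A}

/-- The degree `|a₀| + (|a₁| - 1) + ⋯ + (|aₙ| - 1)`. -/
def deg (c : HWord A) : G := c.g + c.tail.deg

end HWord

/-- The relations of the normalized Hochschild chains: `a₀[a₁|…|aₙ]` is `k`-linear in each
letter, and it vanishes if `aᵢ` is an identity for some `i ≥ 1`. -/
inductive Rel : (HWord A →₀ k) → Prop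
  | head {x y : A.Obj} {g : G} (c : k) (a a' : A.grade x y g) (p : BarWord A x y) :
      Rel (.single ⟨c • a + a', p⟩ 1 - c • .single ⟨a, p⟩ 1 - .single ⟨a', p⟩ 1)
  | tail {x y t s : A.Obj} {g h : G} (a₀ : A.grade x y g) (q : BarWord A x t)
      (c : k) (a a' : A.grade s t h) (r : BarWord A s y) :
      Rel (.single ⟨a₀, q.append (.cons (c • a + a') r)⟩ 1
        - c • .single ⟨a₀, q.append (.cons a r)⟩ 1 - .single ⟨a₀, q.append (.cons a' r)⟩ 1)
  | unit {x y t : A.Obj} {g : G} (a₀ : A.grade x y g) (q : BarWord A x t)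
      (r : BarWord A t y) :
      Rel (.single ⟨a₀, q.append (.cons (A.hone t) r)⟩ 1)

/-- The submodule generated by the relations. -/
noncomputable def relSubmodule : Submodule k (HWord A →₀ k) := Submodule.span k {z | A.Rel z}

/-- The normalized Hochschild chains
`C̄ A = ⨁ Hom(x₁, x₀) ⊗ s(Hom(x₂, x₁)/k·1) ⊗ ⋯ ⊗ s(Hom(x₀, xₙ)/k·1)`, the sum over all `n ≥ 0`
and all `x₀, …, xₙ` (with `k·1` to be read as `0` where source and target differ),
presented by generators and relations. -/
abbrev NormChain : Type _ := (HWord A →₀ k) ⧸ A.relSubmodule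

/-- The class of the word `a₀[a₁|…|aₙ]`. -/
noncomputable def cls {x y : A.Obj} {g : G} (a₀ : A.grade x y g) (p : BarWord A x y) : A.NormChain :=
  A.relSubmodule.mkQ (.single ⟨a₀, p⟩ 1)

/-- For `[a₁|…|aₙ] = q ++ r` the part of `b (a₀[a₁|…|aₙ])` that is indexed by the first
letter `aⱼ` of `r`. It consists of the term with `d aⱼ`, with the sign
`(-1) ^ (|a₀| + |a₁| + ⋯ + |aⱼ₋₁| - j)`, and of
* `(-1) ^ (|a₀| + ⋯ + |aⱼ| - j) a₀[…|aⱼ aⱼ₊₁|…]` if `j < n`,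
* `- (-1) ^ ((|aₙ| - 1) (|a₀| + ⋯ + |aₙ₋₁| - (n - 1))) aₙ a₀[a₁|…|aₙ₋₁]` if `j = n`. -/
noncomputable def bPart {x y : A.Obj} {g : G} (a₀ : A.grade x y g) :
    ∀ {t : A.Obj}, BarWord A x t → BarWord A t y → A.NormChain
  | _, _, .nil => 0
  | _, q, .cons (g := h) a .nil =>
      sgn k (par g + par q.deg + 1) • A.cls a₀ (q.append (.cons (A.hd a) .nil))
      - sgn k ((par h + 1) * (par g + par q.deg)) • A.cls (A.hcomp a a₀) q
  | _, q, .cons (g := h) a (.cons a' r) =>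
      sgn k (par g + par q.deg + 1) • A.cls a₀ (q.append (.cons (A.hd a) (.cons a' r)))
      + sgn k (par g + par q.deg + par h + 1) • A.cls a₀ (q.append (.cons (A.hcomp a a') r))

/-- The part of `b (a₀[a₁|…|aₙ])` that is not in `bPart`: the terms `d a₀[a₁|…|aₙ]` and, if
`n ≥ 1`, `(-1) ^ |a₀| a₀ a₁[a₂|…|aₙ]`. -/
noncomputable def bHead {x y : A.Obj} {g : G} (a₀ : A.grade x y g) : BarWord A x y → A.NormChain
  | .nil => A.cls (A.hd a₀) .nil
  | .cons a p => A.cls (A.hd a₀) (.cons a p) + sgn k (par g) • A.cls (A.hcomp a₀ a) p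

/-- The Hochschild differential on a word. -/
noncomputable def bWord {x y : A.Obj} {g : G} (a₀ : A.grade x y g) (p : BarWord A x y) : A.NormChain :=
  A.bHead a₀ p + (p.splits.map fun z => A.bPart a₀ z.2.1 z.2.2).sum

/-- The term `± 1[aₗ|…|aₙ|a₀|…|aₗ₋₁]` of `B (a₀[a₁|…|aₙ])`, for `q = [a₁|…|aₗ₋₁]` and
`r = [aₗ|…|aₙ]`; the sign is
`(-1) ^ ((|a₀| + ⋯ + |aₗ₋₁| - l) (|aₗ| + ⋯ + |aₙ| - (n - l + 1)))`. -/
noncomputable def BPart {x y : A.Obj} {g : G} (a₀ : A.grade x y g) {t : A.Obj}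
    (q : BarWord A x t) (r : BarWord A t y) : A.NormChain :=
  sgn k ((par g + 1 + par q.deg) * par r.deg) • A.cls (A.hone t) (r.append (.cons a₀ q))

/-- Connes' operator on a word: the sum of the terms above over all `n + 1` cyclic
rotations of `a₀, …, aₙ`. -/
noncomputable def BWord {x y : A.Obj} {g : G} (a₀ : A.grade x y g) (p : BarWord A x y) : A.NormChain :=
  (p.splits.map fun z => A.BPart a₀ z.2.1 z.2.2).sum

/-! ### The operators are well defined -/

section wellDefined

variable {A}

/-- Linearity of a map to chains, in one condition. -/
def IsLin {M V : Type*} [AddCommGroup M] [Module k M] [AddCommGroup V] [Module k V]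
    (f : M → V) : Prop := ∀ (c : k) (a a' : M), f (c • a + a') = c • f a + f a'

lemma IsLin.add {M V : Type*} [AddCommGroup M] [Module k M] [AddCommGroup V] [Module k V]
    {f f' : M → V} (hf : IsLin (k := k) f) (hf' : IsLin (k := k) f') :
    IsLin (k := k) fun a => f a + f' a := by
  intro c a a'; simp only [hf c a a', hf' c a a', smul_add]; abel

lemma IsLin.sub {M V : Type*} [AddCommGroup M] [Module k M] [AddCommGroup V] [Module k V]
    {f f' : M → V} (hf : IsLin (k := k) f) (hf' : IsLin (k := k) f') :
    IsLin (k := k) fun a => f a - f' a := by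
  intro c a a'; simp only [hf c a a', hf' c a a', smul_sub]; abel

lemma IsLin.smul {M V : Type*} [AddCommGroup M] [Module k M] [AddCommGroup V] [Module k V]
    {f : M → V} (s : k) (hf : IsLin (k := k) f) : IsLin (k := k) fun a => s • f a := by
  intro c a a'; simp only [hf c a a', smul_add, smul_comm s c]

lemma IsLin.zero {M V : Type*} [AddCommGroup M] [Module k M] [AddCommGroup V]
    [Module k V] : IsLin (k := k) fun _ : M => (0 : V) := by
  intro c a a'; simp

lemma IsLin.sum {M V ι : Type*} [AddCommGroup M] [Module k M] [AddCommGroup V]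
    [Module k V] (l : List ι) {f : ι → M → V} (hf : ∀ i, IsLin (k := k) (f i)) :
    IsLin (k := k) fun a => (l.map fun i => f i a).sum := by
  induction l with
  | nil => simpa using IsLin.zero
  | cons i l ih => simpa using (hf i).add ih

lemma IsLin.comp' {M M' V : Type*} [AddCommGroup M] [Module k M] [AddCommGroup M']
    [Module k M'] [AddCommGroup V] [Module k V] {f : M' → V} {e : M → M'}
    (hf : IsLin (k := k) f) (he : IsLin (k := k) e) : IsLin (k := k) fun a => f (e a) := by
  intro c a a'; simp only [he c a a', hf c]

lemma isLin_hd {x y : A.Obj} {g : G} :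
    IsLin (k := k) fun a : A.grade x y g => A.hd a := by
  intro c a a'; ext; simp [hd]

lemma isLin_hcomp_left {x y z : A.Obj} {g h : G} (b : A.grade x y h) :
    IsLin (k := k) fun a : A.grade y z g => A.hcomp a b := by
  intro c a a'; ext; simp [hcomp]

lemma isLin_hcomp_right {x y z : A.Obj} {g h : G} (a : A.grade y z g) :
    IsLin (k := k) fun b : A.grade x y h => A.hcomp a b := by
  intro c b b'; ext; simp [hcomp]

lemma isLin_cls_head {x y : A.Obj} {g : G} (p : BarWord A x y) :
    IsLin (k := k) fun a : A.grade x y g => A.cls a p := by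
  intro c a a'
  have := (Submodule.Quotient.mk_eq_zero A.relSubmodule).2
    (Submodule.subset_span (Rel.head c a a' p))
  simp only [cls]
  rw [← sub_eq_zero, ← map_smul, ← sub_sub, ← map_sub, ← map_sub]
  exact this

lemma isLin_cls_tail {x y t s : A.Obj} {g h : G} (a₀ : A.grade x y g)
    (q : BarWord A x t) (r : BarWord A s y) :
    IsLin (k := k) fun a : A.grade s t h => A.cls a₀ (q.append (.cons a r)) := by
  intro c a a'
  have := (Submodule.Quotient.mk_eq_zero A.relSubmodule).2
    (Submodule.subset_span (Rel.tail a₀ q c a a' r))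
  simp only [cls]
  rw [← sub_eq_zero, ← map_smul, ← sub_sub, ← map_sub, ← map_sub]
  exact this

lemma cls_unit {x y t : A.Obj} {g : G} (a₀ : A.grade x y g) (q : BarWord A x t)
    (r : BarWord A t y) : A.cls a₀ (q.append (.cons (A.hone t) r)) = 0 :=
  (Submodule.Quotient.mk_eq_zero A.relSubmodule).2 (Submodule.subset_span (Rel.unit a₀ q r))

namespace BarWord

@[simp] lemma nil_append {t s : A.Obj} (r : BarWord A t s) : nil.append r = r := rfl

@[simp] lemma cons_append {t t' y s : A.Obj} {g : G} (a : A.grade t t' g) (p : BarWord A t y)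
    (r : BarWord A y s) : (cons a p).append r = cons a (p.append r) := rfl

@[simp] lemma append_nil {t s : A.Obj} (p : BarWord A t s) : p.append nil = p := by
  induction p with
  | nil => rfl
  | cons a p ih => rw [cons_append, ih]

lemma append_assoc {t y z s : A.Obj} (p : BarWord A t y) (q : BarWord A y z)
    (r : BarWord A z s) : (p.append q).append r = p.append (q.append r) := by
  induction p with
  | nil => rfl
  | cons a p ih => simp only [cons_append, ih]

lemma deg_append {t y s : A.Obj} (p : BarWord A t y) (q : BarWord A y s) :
    (p.append q).deg = p.deg + q.deg := by
  induction p with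
  | nil => simp [deg]
  | cons a p ih => simp only [cons_append, deg, ih, add_assoc]

/-- The splittings of `q₀ ++ [a] ++ r₀`: the letter `a` lies on the right or on the left. -/
lemma sum_splits_append {V : Type*} [AddCommGroup V] {t y z s : A.Obj} {g : G}
    (q₀ : BarWord A t y) (a : A.grade z y g) (r₀ : BarWord A z s)
    (F : ∀ w, BarWord A t w → BarWord A w s → V) :
    ((q₀.append (cons a r₀)).splits.map fun z => F z.1 z.2.1 z.2.2).sum
      = (q₀.splits.map fun z => F z.1 z.2.1 (z.2.2.append (cons a r₀))).sum
        + (r₀.splits.map fun z => F z.1 (q₀.append (cons a z.2.1)) z.2.2).sum := by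
  induction q₀ with
  | nil => simp [splits, Function.comp_def]
  | cons c q ih =>
    simp only [cons_append, splits, List.map_cons, List.map_map, List.sum_cons,
      Function.comp_def]
    rw [ih a fun w p r => F w (cons c p) r, add_assoc]

/-- A telescoping sum over the splittings. -/
lemma sum_splits_telescope {V : Type*} [AddCommGroup V] {t s : A.Obj}
    (p : BarWord A t s) (F : ∀ w, BarWord A t w → BarWord A w s → V)
    (h₂ : ∀ {w x y : A.Obj} {g h : G} (q : BarWord A t w) (c : A.grade x w g)
      (e : A.grade y x h) (r : BarWord A y s), F w q (cons c (cons e r)) = 0)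
    (h₁ : ∀ {w : A.Obj} {g : G} (q : BarWord A t w) (c : A.grade s w g),
      F w q (cons c nil) + F s (q.append (cons c nil)) nil = 0) :
    (p.splits.map fun z => F z.1 z.2.1 z.2.2).sum
      = match t, s, p, F with
        | _, _, nil, F => F _ nil nil
        | _, _, cons _ _, _ => 0 := by
  induction p with
  | nil => simp [splits]
  | cons a p ih =>
    simp only [splits, List.map_cons, List.map_map, List.sum_cons, Function.comp_def]
    rw [ih (fun w q r => F w (cons a q) r) (fun q c e r => h₂ (cons a q) c e r)
      (fun q c => h₁ (cons a q) c)]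
    cases p with
    | nil => simpa using h₁ nil a
    | cons e r => simpa using h₂ nil a e r

end BarWord


lemma sgn_add (p q : ZMod 2) : sgn k (p + q) = sgn k p * sgn k q := by
  have h : ∀ p : ZMod 2, p = 0 ∨ p = 1 := by decide
  rcases h p with rfl | rfl <;> rcases h q with rfl | rfl <;>
    simp [sgn, show (1 + 1 : ZMod 2) = 0 from rfl]

lemma sgn_one : sgn k 1 = -1 := by simp [sgn]

lemma sgn_zero : sgn k 0 = 1 := by simp [sgn]

lemma d_one (x : A.Obj) : A.d x x (A.one x) = 0 := by
  have h := A.d_comp (A.one_mem x) (A.one x)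
  rw [A.comp_one, A.comp_one, A.one_comp] at h
  simpa using h

lemma cls_congr {x y : A.Obj} {g g' : G} {a : A.grade x y g} {a' : A.grade x y g'}
    (hg : g = g') (ha : (a : A.Hom x y) = a') (p : BarWord A x y) : A.cls a p = A.cls a' p := by
  subst hg; obtain rfl := Subtype.ext ha; rfl

lemma cls_tail_congr {x y t s : A.Obj} {g h h' : G} (a₀ : A.grade x y g)
    {a : A.grade s t h} {a' : A.grade s t h'} (hh : h = h') (ha : (a : A.Hom s t) = a')
    (q : BarWord A x t) (r : BarWord A s y) :
    A.cls a₀ (q.append (.cons a r)) = A.cls a₀ (q.append (.cons a' r)) := by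
  subst hh; obtain rfl := Subtype.ext ha; rfl

lemma cls_head_zero {x y : A.Obj} {g : G} {a : A.grade x y g} (ha : (a : A.Hom x y) = 0)
    (p : BarWord A x y) : A.cls a p = 0 := by
  obtain rfl : a = 0 := Subtype.ext ha
  have := isLin_cls_head (A := A) (g := g) p (1 : k) 0 0
  simp only [smul_zero, add_zero, one_smul] at this
  exact left_eq_add.1 this

lemma cls_tail_zero {x y t s : A.Obj} {g h : G} (a₀ : A.grade x y g)
    {a : A.grade s t h} (ha : (a : A.Hom s t) = 0)
    (q : BarWord A x t) (r : BarWord A s y) : A.cls a₀ (q.append (.cons a r)) = 0 := by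
  obtain rfl : a = 0 := Subtype.ext ha
  have := isLin_cls_tail (A := A) (h := h) a₀ q r (1 : k) 0 0
  simp only [smul_zero, add_zero, one_smul] at this
  exact left_eq_add.1 this

/-- A slot to the left of a letter. -/
lemma isLin_cls_left {x y t s z : A.Obj} {g h : G} (a₀ : A.grade x y g)
    (q : BarWord A x t) (r : BarWord A s z) (r' : BarWord A z y) :
    IsLin (k := k) fun a : A.grade s t h => A.cls a₀ ((q.append (.cons a r)).append r') := by
  simp only [BarWord.append_assoc, BarWord.cons_append]
  exact isLin_cls_tail a₀ q _

lemma cls_unit_left {x y t z : A.Obj} {g : G} (a₀ : A.grade x y g)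
    (q : BarWord A x t) (r : BarWord A t z) (r' : BarWord A z y) :
    A.cls a₀ ((q.append (.cons (A.hone t) r)).append r') = 0 := by
  simp only [BarWord.append_assoc, BarWord.cons_append]
  exact cls_unit a₀ q _

/-- A slot two letters into the right part. -/
lemma isLin_cls_right {x y t s z w : A.Obj} {g h l : G} (a₀ : A.grade x y g)
    (q : BarWord A x t) (c : A.grade w t l) (r : BarWord A w z) (r' : BarWord A s y) :
    IsLin (k := k) fun a : A.grade s z h =>
      A.cls a₀ (q.append (.cons c (r.append (.cons a r')))) := by
  have := isLin_cls_tail (A := A) (h := h) a₀ (q.append (.cons c r)) r'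
  simpa only [BarWord.append_assoc, BarWord.cons_append] using this

lemma cls_unit_right {x y t z w : A.Obj} {g l : G} (a₀ : A.grade x y g)
    (q : BarWord A x t) (c : A.grade w t l) (r : BarWord A w z) (r' : BarWord A z y) :
    A.cls a₀ (q.append (.cons c (r.append (.cons (A.hone z) r')))) = 0 := by
  have := cls_unit (A := A) a₀ (q.append (.cons c r)) r'
  simpa only [BarWord.append_assoc, BarWord.cons_append] using this

lemma isLin_bPart_head {x y t : A.Obj} {g : G} (q : BarWord A x t) (r : BarWord A t y) :
    IsLin (k := k) fun a₀ : A.grade x y g => A.bPart a₀ q r := by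
  match r with
  | .nil => simpa only [bPart] using IsLin.zero
  | .cons a .nil =>
    simp only [bPart]
    exact ((isLin_cls_head _).smul _).sub
      (((isLin_cls_head q).comp' (isLin_hcomp_right a)).smul _)
  | .cons a (.cons a' r) =>
    simp only [bPart]
    exact ((isLin_cls_head _).smul _).add ((isLin_cls_head _).smul _)

lemma isLin_bPart_left {x y t s z : A.Obj} {g h : G} (a₀ : A.grade x y g)
    (q : BarWord A x t) (q' : BarWord A s z) (r : BarWord A z y) :
    IsLin (k := k) fun a : A.grade s t h => A.bPart a₀ (q.append (.cons a q')) r := by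
  rcases r with _ | ⟨e, _ | ⟨e', r⟩⟩
  · simpa only [bPart] using IsLin.zero
  · simp only [bPart, BarWord.deg_append, BarWord.deg]
    exact ((isLin_cls_left _ _ _ _).smul _).sub ((isLin_cls_tail _ _ _).smul _)
  · simp only [bPart, BarWord.deg_append, BarWord.deg]
    exact ((isLin_cls_left _ _ _ _).smul _).add ((isLin_cls_left _ _ _ _).smul _)

lemma isLin_bPart_right {x y t s z : A.Obj} {g h : G} (a₀ : A.grade x y g)
    (q : BarWord A x t) (r : BarWord A t z) (r' : BarWord A s y) :
    IsLin (k := k) fun a : A.grade s z h => A.bPart a₀ q (r.append (.cons a r')) := by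
  match r with
  | .nil =>
    cases r' with
    | nil =>
      simp only [BarWord.nil_append, bPart]
      exact (((isLin_cls_tail a₀ q _).comp' isLin_hd).smul _).sub
        (((isLin_cls_head q).comp' (isLin_hcomp_left a₀)).smul _)
    | cons e r' =>
      simp only [BarWord.nil_append, bPart]
      exact (((isLin_cls_tail a₀ q _).comp' isLin_hd).smul _).add
        (((isLin_cls_tail a₀ q _).comp' (isLin_hcomp_left e)).smul _)
  | .cons c .nil =>
    simp only [BarWord.nil_append, BarWord.cons_append, bPart]
    exact ((isLin_cls_right a₀ q (A.hd c) .nil r').smul _).add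
      (((isLin_cls_tail a₀ q _).comp' (isLin_hcomp_right c)).smul _)
  | .cons c (.cons e r) =>
    simp only [BarWord.cons_append, bPart]
    exact ((isLin_cls_right a₀ q (A.hd c) (.cons e r) r').smul _).add
      ((isLin_cls_right a₀ q (A.hcomp c e) r r').smul _)

lemma isLin_bWord_head {x y : A.Obj} {g : G} (p : BarWord A x y) :
    IsLin (k := k) fun a₀ : A.grade x y g => A.bWord a₀ p := by
  refine IsLin.add ?_ (IsLin.sum _ fun z => isLin_bPart_head _ _)
  cases p with
  | nil => exact (isLin_cls_head _).comp' isLin_hd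
  | cons a p =>
    exact ((isLin_cls_head _).comp' isLin_hd).add
      (((isLin_cls_head p).comp' (isLin_hcomp_left a)).smul _)

lemma isLin_bWord_tail {x y t s : A.Obj} {g h : G} (a₀ : A.grade x y g)
    (q : BarWord A x t) (r : BarWord A s y) :
    IsLin (k := k) fun a : A.grade s t h => A.bWord a₀ (q.append (.cons a r)) := by
  simp only [bWord, BarWord.sum_splits_append (F := fun w q r => A.bPart a₀ q r)]
  refine IsLin.add ?_ (IsLin.add (IsLin.sum _ fun z => isLin_bPart_right _ _ _ _)
    (IsLin.sum _ fun z => isLin_bPart_left _ _ _ _))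
  cases q with
  | nil =>
    exact (isLin_cls_tail (A.hd a₀) .nil r).add
      (((isLin_cls_head r).comp' (isLin_hcomp_right a₀)).smul _)
  | cons c q =>
    exact (isLin_cls_tail (A.hd a₀) (.cons c q) r).add
      ((isLin_cls_tail (A.hcomp a₀ c) q r).smul _)

lemma bPart_left_unit {x y t z : A.Obj} {g : G} (a₀ : A.grade x y g)
    (q : BarWord A x t) (q' : BarWord A t z) (r : BarWord A z y) :
    A.bPart a₀ (q.append (.cons (A.hone t) q')) r = 0 := by
  rcases r with _ | ⟨e, _ | ⟨e', r⟩⟩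
  · simp only [bPart]
  · simp only [bPart, cls_unit_left, cls_unit, smul_zero, sub_zero]
  · simp only [bPart, cls_unit_left, smul_zero, add_zero]

lemma bPart_right_unit_two {x y t s z w : A.Obj} {g h l : G} (a₀ : A.grade x y g)
    (q : BarWord A x t) (c : A.grade w t h) (e : A.grade z w l) (r : BarWord A z s)
    (r' : BarWord A s y) :
    A.bPart a₀ q ((BarWord.cons c (.cons e r)).append (.cons (A.hone s) r')) = 0 := by
  have h₁ := cls_unit_right a₀ q (A.hd c) (.cons e r) r'
  have h₂ := cls_unit_right a₀ q (A.hcomp c e) r r'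
  simp only [BarWord.cons_append] at h₁ ⊢
  simp only [bPart, h₁, h₂, smul_zero, add_zero]

lemma bPart_right_unit_one {x y t w : A.Obj} {g h : G} (a₀ : A.grade x y g)
    (q : BarWord A x t) (c : A.grade w t h) (r' : BarWord A w y) :
    A.bPart a₀ q ((BarWord.cons c .nil).append (.cons (A.hone w) r'))
      = sgn k (par g + par q.deg + par h + 1) • A.cls a₀ (q.append (.cons c r')) := by
  have h₁ := cls_unit_right a₀ q (A.hd c) .nil r'
  simp only [BarWord.nil_append] at h₁
  simp only [BarWord.cons_append, BarWord.nil_append, bPart, h₁, smul_zero, zero_add]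
  rw [cls_tail_congr a₀ (a := A.hcomp c (A.hone w)) (a' := c) (add_zero _) (A.comp_one _)]

lemma bPart_right_unit_zero {x y t : A.Obj} {g : G} (a₀ : A.grade x y g)
    (q : BarWord A x t) (r' : BarWord A t y) :
    A.bPart a₀ q (.cons (A.hone t) r')
      = - sgn k (par g + par q.deg) • A.cls a₀ (q.append r') := by
  cases r' with
  | nil =>
    simp only [bPart, cls_tail_zero a₀ (a := A.hd (A.hone _)) (A.d_one _), smul_zero, zero_sub,
      BarWord.append_nil]
    rw [cls_congr (a := A.hcomp (A.hone _) a₀) (a' := a₀) (zero_add _) (A.one_comp _)]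
    simp [par]
  | cons e r' =>
    simp only [bPart, cls_tail_zero a₀ (a := A.hd (A.hone _)) (A.d_one _), smul_zero, zero_add]
    rw [cls_tail_congr a₀ (a := A.hcomp (A.hone _) e) (a' := e) (zero_add _) (A.one_comp _)]
    simp [par, sgn_add, sgn_one]

lemma bWord_unit {x y t : A.Obj} {g : G} (a₀ : A.grade x y g) (q : BarWord A x t)
    (r : BarWord A t y) : A.bWord a₀ (q.append (.cons (A.hone t) r)) = 0 := by
  have key := BarWord.sum_splits_telescope q
    (fun w p p' => A.bPart a₀ p (p'.append (.cons (A.hone t) r)))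
    (fun p c e p' => bPart_right_unit_two a₀ p c e p' r)
    (fun {w h} p c => by
      rw [bPart_right_unit_one]
      simp only [BarWord.nil_append, bPart_right_unit_zero,
        BarWord.append_assoc, BarWord.cons_append, BarWord.deg_append, BarWord.deg]
      rw [← add_smul]
      have : par (p.deg + (h - 1 + 0)) = par p.deg + par h + 1 := by
        simp only [par, map_add, map_sub, GradingParity.parity_one, add_zero,
          CharTwo.sub_eq_add, add_assoc]
      rw [this]
      simp only [sgn_add, sgn_one, mul_neg, mul_one, mul_assoc, neg_neg,
        neg_add_cancel, zero_smul])
  simp only [bWord, BarWord.sum_splits_append (F := fun w q r => A.bPart a₀ q r), key,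
    bPart_left_unit]
  cases q with
  | nil =>
    have h₁ := cls_unit (A.hd a₀) .nil r
    simp only [BarWord.nil_append] at h₁
    simp only [BarWord.nil_append, bHead, h₁, zero_add, bPart_right_unit_zero, BarWord.deg]
    rw [cls_congr (a := A.hcomp a₀ (A.hone _)) (a' := a₀) (add_zero _) (A.comp_one _)]
    simp [par]
  | cons c q =>
    have h₁ := cls_unit (A.hd a₀) (.cons c q) r
    simp only [BarWord.cons_append] at h₁
    simp [bHead, h₁, cls_unit]

lemma isLin_BPart_left {x y t s z : A.Obj} {g h : G} (a₀ : A.grade x y g)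
    (q : BarWord A x t) (q' : BarWord A s z) (r : BarWord A z y) :
    IsLin (k := k) fun a : A.grade s t h => A.BPart a₀ (q.append (.cons a q')) r := by
  simp only [BPart, BarWord.deg_append, BarWord.deg]
  have := isLin_cls_tail (A := A) (h := h) (A.hone z) (r.append (.cons a₀ q)) q'
  simp only [BarWord.append_assoc, BarWord.cons_append] at this
  exact this.smul _

lemma isLin_BPart_right {x y t s z : A.Obj} {g h : G} (a₀ : A.grade x y g)
    (q : BarWord A x t) (r : BarWord A t z) (r' : BarWord A s y) :
    IsLin (k := k) fun a : A.grade s z h => A.BPart a₀ q (r.append (.cons a r')) := by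
  simp only [BPart, BarWord.deg_append, BarWord.deg]
  exact (isLin_cls_left _ _ _ _).smul _

lemma isLin_BWord_head {x y : A.Obj} {g : G} (p : BarWord A x y) :
    IsLin (k := k) fun a₀ : A.grade x y g => A.BWord a₀ p :=
  IsLin.sum _ fun _ => (isLin_cls_tail _ _ _).smul _

lemma isLin_BWord_tail {x y t s : A.Obj} {g h : G} (a₀ : A.grade x y g)
    (q : BarWord A x t) (r : BarWord A s y) :
    IsLin (k := k) fun a : A.grade s t h => A.BWord a₀ (q.append (.cons a r)) := by
  simp only [BWord, BarWord.sum_splits_append (F := fun w q r => A.BPart a₀ q r)]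
  exact IsLin.add (IsLin.sum _ fun z => isLin_BPart_right _ _ _ _)
    (IsLin.sum _ fun z => isLin_BPart_left _ _ _ _)

lemma BWord_unit {x y t : A.Obj} {g : G} (a₀ : A.grade x y g) (q : BarWord A x t)
    (r : BarWord A t y) : A.BWord a₀ (q.append (.cons (A.hone t) r)) = 0 := by
  have h₁ : ∀ {z : A.Obj} (p : BarWord A x z) (p' : BarWord A z t),
      A.BPart a₀ p (p'.append (.cons (A.hone t) r)) = 0 := fun p p' => by
    simp only [BPart, cls_unit_left, smul_zero]
  have h₂ : ∀ {z : A.Obj} (p : BarWord A t z) (p' : BarWord A z y),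
      A.BPart a₀ (q.append (.cons (A.hone t) p)) p' = 0 := fun {z} p p' => by
    have := cls_unit (A.hone z) (p'.append (.cons a₀ q)) p
    simp only [BarWord.append_assoc, BarWord.cons_append] at this
    simp only [BPart, this, smul_zero]
  simp only [BWord, BarWord.sum_splits_append (F := fun w q r => A.BPart a₀ q r), h₁, h₂]
  simp

/-- A map on words that is linear in every letter and vanishes on words with an identity in a
position `≥ 1` is compatible with the relations. -/
lemma relSubmodule_le_ker {V : Type*} [AddCommGroup V] [Module k V]
    (f : ∀ {x y : A.Obj} {g : G}, A.grade x y g → BarWord A x y → V)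
    (hhead : ∀ {x y : A.Obj} {g : G} (p : BarWord A x y),
      IsLin (k := k) fun a : A.grade x y g => f a p)
    (htail : ∀ {x y t s : A.Obj} {g h : G} (a₀ : A.grade x y g) (q : BarWord A x t)
      (r : BarWord A s y), IsLin (k := k) fun a : A.grade s t h => f a₀ (q.append (.cons a r)))
    (hunit : ∀ {x y t : A.Obj} {g : G} (a₀ : A.grade x y g) (q : BarWord A x t)
      (r : BarWord A t y), f a₀ (q.append (.cons (A.hone t) r)) = 0) :
    A.relSubmodule ≤ LinearMap.ker
      (Finsupp.linearCombination k fun c : HWord A => f c.head c.tail) := by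
  refine Submodule.span_le.2 ?_
  rintro z (⟨c, a, a', p⟩ | ⟨a₀, q, c, a, a', r⟩ | ⟨a₀, q, r⟩)
  · simpa [sub_sub, sub_eq_zero] using hhead p c a a'
  · simpa [sub_sub, sub_eq_zero] using htail a₀ q r c a a'
  · simpa using hunit a₀ q r

end wellDefined

/-- The Hochschild differential `b` on the normalized chains. -/
noncomputable def b : A.NormChain →ₗ[k] A.NormChain :=
  A.relSubmodule.liftQ (Finsupp.linearCombination k fun c : HWord A => A.bWord c.head c.tail)
    (relSubmodule_le_ker (fun a p => A.bWord a p) isLin_bWord_head isLin_bWord_tail bWord_unit)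

/-- Connes' operator `B` on the normalized chains. -/
noncomputable def B : A.NormChain →ₗ[k] A.NormChain :=
  A.relSubmodule.liftQ (Finsupp.linearCombination k fun c : HWord A => A.BWord c.head c.tail)
    (relSubmodule_le_ker (fun a p => A.BWord a p) isLin_BWord_head isLin_BWord_tail BWord_unit)

@[simp] lemma b_cls {x y : A.Obj} {g : G} (a₀ : A.grade x y g) (p : BarWord A x y) :
    A.b (A.cls a₀ p) = A.bWord a₀ p := by simp [b, cls]

@[simp] lemma B_cls {x y : A.Obj} {g : G} (a₀ : A.grade x y g) (p : BarWord A x y) :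
    A.B (A.cls a₀ p) = A.BWord a₀ p := by simp [B, cls]

/-- The normalized chains of degree `g`. -/
noncomputable def chainDeg (g : G) : Submodule k A.NormChain :=
  Submodule.span k {z | ∃ c : HWord A, c.deg = g ∧ z = A.cls c.head c.tail}

/-- The `k[[u]]`-module `C̄ A [[u]]`: a sequence `z` stands for `∑ i, z i * u ^ i`. -/
abbrev NegChain : Type _ := ℕ → A.NormChain

/-- The elements of degree `g` of `C̄ A [[u]]`, where `u` has degree `2`. -/
noncomputable def negDeg (g : G) : Submodule k A.NegChain :=
  Submodule.pi Set.univ fun i : ℕ => A.chainDeg (g - ((2 * i : ℕ) : G))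

/-- Multiplication by `u` on `C̄ A [[u]]`. -/
noncomputable def uMul : A.NegChain →ₗ[k] A.NegChain where
  toFun z i := match i with
    | 0 => 0
    | i + 1 => z i
  map_add' z z' := by ext i; cases i <;> simp
  map_smul' c z := by ext i; cases i <;> simp

/-- The differential `b + u B` of the normalized negative cyclic complex `C̄ A [[u]]`. -/
noncomputable def negDiff : A.NegChain →ₗ[k] A.NegChain :=
  A.b.compLeft ℕ + A.uMul ∘ₗ A.B.compLeft ℕ

/-- The cycles of degree `g` of the normalized negative cyclic complex. -/
def IsNegCycle (g : G) (z : A.NegChain) : Prop := z ∈ A.negDeg g ∧ A.negDiff z = 0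

/-- Two elements of degree `g` of the normalized negative cyclic complex differ by the boundary
of an element of degree `g - 1` (the differential has degree `1`). -/
def NegHomologous (g : G) (z z' : A.NegChain) : Prop :=
  ∃ w ∈ A.negDeg (g - 1), A.negDiff w = z - z'

/-- The element `1_P` of `C̄ A [[u]]`, concentrated in `u`-degree `0`. -/
noncomputable def oneCycle (P : A.Obj) : A.NegChain := Pi.single 0 (A.cls (A.hone P) .nil)

/-- The element
`η_π = π + ∑_{i ≥ 1} (-1) ^ i ((2 i)! / (2 (i!))) (2 π - 1_N)[π|…|π] u ^ i` of `C̄ A [[u]]`, with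
`2 i` copies of `π`. The natural number division is exact, see `two_mul_factorial_dvd`. -/
noncomputable def eta (N : A.Obj) (π : A.grade N N (0 : G)) : A.NegChain
  | 0 => A.cls π .nil
  | i + 1 =>
      ((-1) ^ (i + 1) * (((2 * (i + 1)).factorial / (2 * (i + 1).factorial) : ℕ) : k)) •
        A.cls ((2 : k) • π - A.hone N) (BarWord.rep π (2 * (i + 1)))

lemma two_mul_factorial_dvd (i : ℕ) :
    2 * (i + 1).factorial ∣ (2 * (i + 1)).factorial := by
  rw [show 2 * (i + 1) = 2 * i + 1 + 1 by ring, Nat.factorial_succ (2 * i + 1),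
    Nat.factorial_succ i, show 2 * i + 1 + 1 = 2 * (i + 1) by ring, ← mul_assoc]
  exact mul_dvd_mul_left _ (Nat.factorial_dvd_factorial (by lia))

lemma comp_mem_zero {x y z : A.Obj} {f : A.Hom y z} {f' : A.Hom x y}
    (hf : f ∈ A.grade y z 0) (hf' : f' ∈ A.grade x y 0) : A.comp f f' ∈ A.grade x z 0 := by
  simpa using A.comp_mem hf hf'

end DGCategory

universe u' v'

/-!
If every identity of a dg category is a finite sum `∑ i, incl i ∘ proj i` of closed maps of degree
`0` factoring through fixed objects, then `a₀[p] ↦ ± ∑ i, (a₀ ∘ incl i)[proj i|p]` contracts the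
words `a₀[c|p]` in which `c` slides through the summands, `c ∘ incl i = λᵢ • incl i` and
`proj i ∘ c = λᵢ • proj i`: a separability idempotent gives a contraction of the bar complex.
When `P` is a summand of `N`, splitting `1_N` into `incl ∘ proj` and the square of the complementary
idempotent makes `incl`, `proj` and `π` diagonal in this sense. Starting from
`b (proj[incl]) = 1_P - π`, one lifts `1_P - η_π` to a boundary of `b + u B` one power of `u` at a
time: each obstruction is a `b`-cycle in the span of the words of positive length in diagonal
letters, so the contraction supplies the next coefficient.

The decomposition treats `P` and `N` differently, which is impossible if they are the same object;
so the argument is run in a dg category with two formally distinct objects and pushed forward.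
-/

namespace DGCategory

variable {k : Type w'} [CommRing k] {G : Type w} [AddCommGroupWithOne G] [GradingParity G]

section complexes

variable {A : DGCategory.{u, v} k G}

section parity

lemma par_add (g h : G) : par (g + h) = par g + par h := map_add _ g h

lemma par_zero : par (0 : G) = 0 := map_zero _

lemma par_add_one (g : G) : par (g + 1) = par g + 1 := by
  rw [par_add, show par (1 : G) = 1 from GradingParity.parity_one]

lemma BarWord.par_deg_nil {x : A.Obj} : par (nil : BarWord A x x).deg = 0 := par_zero

lemma BarWord.par_deg_cons {t y s : A.Obj} {g : G} (a : A.grade y t g) (p : BarWord A y s) :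
    par (BarWord.cons a p).deg = par g + 1 + par p.deg := by
  rw [deg, par_add, par, map_sub, GradingParity.parity_one, CharTwo.sub_eq_add]

lemma BarWord.par_deg_append {t y s : A.Obj} (p : BarWord A t y) (q : BarWord A y s) :
    par (p.append q).deg = par p.deg + par q.deg := by
  rw [deg_append, par_add]

end parity

namespace BarWord

variable {V : Type*} [AddCommGroup V]

section operators

/-- The sum of `F q r` over all factorizations `p = q ++ r`. -/
def sumSplits {t s : A.Obj} (p : BarWord A t s)
    (F : ∀ {y : A.Obj}, BarWord A t y → BarWord A y s → V) : V :=
  (p.splits.map fun z => F z.2.1 z.2.2).sum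

/-- The sum of `F q c r` over all factorizations `p = q ++ [c] ++ r` singling out a letter. -/
def sumLetters : ∀ {t s : A.Obj}, BarWord A t s →
    (∀ {y z : A.Obj} {g : G}, BarWord A t y → A.grade z y g → BarWord A z s → V) → V
  | _, _, nil, _ => 0
  | _, _, cons a p, F => F nil a p + sumLetters p fun q c r => F (cons a q) c r

/-- The value `f c q` if `p = [c] ++ q`, and `0` for the empty word. -/
def splitFirst : ∀ {t s : A.Obj}, BarWord A t s →
    (∀ {y : A.Obj} {g : G}, A.grade y t g → BarWord A y s → V) → V
  | _, _, nil, _ => 0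
  | _, _, cons c q, f => f c q

/-- The value `f q c` if `p = q ++ [c]`, and `0` for the empty word. -/
def splitLast : ∀ {t s : A.Obj}, BarWord A t s →
    (∀ {y : A.Obj} {g : G}, BarWord A t y → A.grade s y g → V) → V
  | _, _, nil, _ => 0
  | _, _, cons c nil, f => f nil c
  | _, _, cons a (cons c q), f => splitLast (cons c q) fun q c => f (cons a q) c

variable [Module k V]

/-- The bar differential: the extension along `f` of the signed sum of the words obtained from a
bar word by differentiating one letter or by composing two adjacent letters. Going through `f`
avoids forming linear combinations of words. -/
def barDiff : ∀ {t s : A.Obj}, BarWord A t s → (BarWord A t s → V) → V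
  | _, _, nil, _ => 0
  | _, _, cons (g := g) a p, f =>
      f (cons (A.hd a) p) + sgn k (par g) • p.splitFirst (fun c q => f (cons (A.hcomp a c) q))
        + sgn k (par g + 1) • barDiff p fun q => f (cons a q)

end operators

section sumSplits

variable {t s : A.Obj}

@[simp] lemma sumSplits_nil (F : ∀ {y : A.Obj}, BarWord A t y → BarWord A y t → V) :
    (nil : BarWord A t t).sumSplits F = F nil nil := by simp [sumSplits, splits]

@[simp] lemma sumSplits_cons {x : A.Obj} {g : G} (a : A.grade t x g) (p : BarWord A t s)
    (F : ∀ {y : A.Obj}, BarWord A x y → BarWord A y s → V) :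
    (cons a p).sumSplits F = F nil (cons a p) + p.sumSplits fun q r => F (cons a q) r := by
  simp [sumSplits, splits, Function.comp_def]

lemma sumSplits_congr (p : BarWord A t s)
    {F F' : ∀ {y : A.Obj}, BarWord A t y → BarWord A y s → V}
    (h : ∀ {y : A.Obj} (q : BarWord A t y) (r : BarWord A y s), q.append r = p → F q r = F' q r) :
    p.sumSplits F = p.sumSplits F' := by
  induction p with
  | nil => simpa using h nil nil rfl
  | cons a p ih =>
    rw [sumSplits_cons, sumSplits_cons, h nil _ rfl,
      ih fun q r hqr => h (cons a q) r (congrArg (cons a) hqr)]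

lemma sumSplits_add (p : BarWord A t s)
    (F F' : ∀ {y : A.Obj}, BarWord A t y → BarWord A y s → V) :
    (p.sumSplits fun q r => F q r + F' q r) = p.sumSplits F + p.sumSplits F' :=
  List.sum_map_add

lemma sumSplits_sub (p : BarWord A t s)
    (F F' : ∀ {y : A.Obj}, BarWord A t y → BarWord A y s → V) :
    (p.sumSplits fun q r => F q r - F' q r) = p.sumSplits F - p.sumSplits F' := by
  induction p with
  | nil => simp only [sumSplits_nil]
  | cons a p ih => simp only [sumSplits_cons, ih]; abel

lemma sumSplits_map {W : Type*} [AddCommGroup W] [Module k V] [Module k W] (φ : V →ₗ[k] W)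
    (p : BarWord A t s)
    (F : ∀ {y : A.Obj}, BarWord A t y → BarWord A y s → V) :
    φ (p.sumSplits F) = p.sumSplits fun q r => φ (F q r) := by
  simp [sumSplits, map_list_sum, Function.comp_def]

lemma sumSplits_smul [Module k V] (c : k) (p : BarWord A t s)
    (F : ∀ {y : A.Obj}, BarWord A t y → BarWord A y s → V) :
    (p.sumSplits fun q r => c • F q r) = c • p.sumSplits F :=
  (sumSplits_map (DistribSMul.toLinearMap k V c) p F).symm

lemma sumSplits_eq_zero (p : BarWord A t s)
    {F : ∀ {y : A.Obj}, BarWord A t y → BarWord A y s → V}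
    (h : ∀ {y : A.Obj} (q : BarWord A t y) (r : BarWord A y s), F q r = 0) :
    p.sumSplits F = 0 := by
  simp only [sumSplits, h, List.map_const', List.sum_replicate, smul_zero]

lemma sumSplits_eq_add_sumLetters_right (p : BarWord A t s)
    (F : ∀ {y : A.Obj}, BarWord A t y → BarWord A y s → V) :
    p.sumSplits F = F p nil + p.sumLetters fun q c r => F q (cons c r) := by
  induction p with
  | nil => simp [sumLetters]
  | cons a p ih => rw [sumSplits_cons, ih, sumLetters]; abel

lemma sumSplits_eq_add_sumLetters_left (p : BarWord A t s)
    (F : ∀ {y : A.Obj}, BarWord A t y → BarWord A y s → V) :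
    p.sumSplits F = F nil p + p.sumLetters fun q c r => F (q.append (cons c nil)) r := by
  induction p with
  | nil => simp [sumLetters]
  | cons a p ih => rw [sumSplits_cons, ih, sumLetters]; rfl

end sumSplits

section splitFirst

variable {t s : A.Obj}

lemma splitFirst_congr (p : BarWord A t s)
    {f f' : ∀ {y : A.Obj} {g : G}, A.grade y t g → BarWord A y s → V}
    (h : ∀ {y : A.Obj} {g : G} (c : A.grade y t g) (q : BarWord A y s),
      cons c q = p → f c q = f' c q) :
    p.splitFirst f = p.splitFirst f' := by
  cases p with
  | nil => rfl
  | cons a p => exact h a p rfl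

lemma splitFirst_map {W : Type*} [AddCommGroup W] [Module k V] [Module k W] (φ : V →ₗ[k] W)
    (p : BarWord A t s)
    (f : ∀ {y : A.Obj} {g : G}, A.grade y t g → BarWord A y s → V) :
    φ (p.splitFirst f) = p.splitFirst fun c q => φ (f c q) := by
  cases p with
  | nil => exact map_zero φ
  | cons a p => rfl

lemma splitFirst_add (p : BarWord A t s)
    (f f' : ∀ {y : A.Obj} {g : G}, A.grade y t g → BarWord A y s → V) :
    (p.splitFirst fun c q => f c q + f' c q) = p.splitFirst f + p.splitFirst f' := by
  cases p with
  | nil => exact (add_zero 0).symm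
  | cons a p => rfl

lemma splitFirst_smul [Module k V] (c : k) (p : BarWord A t s)
    (f : ∀ {y : A.Obj} {g : G}, A.grade y t g → BarWord A y s → V) :
    (p.splitFirst fun a q => c • f a q) = c • p.splitFirst f :=
  (splitFirst_map (DistribSMul.toLinearMap k V c) p f).symm

lemma splitFirst_sumSplits (p : BarWord A t s)
    (F : ∀ {x y : A.Obj} {g : G}, A.grade x t g → BarWord A x y → BarWord A y s → V) :
    (p.splitFirst fun c p' => p'.sumSplits fun q r => F c q r)
      = p.sumSplits fun q r => q.splitFirst fun c q' => F c q' r := by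
  cases p with
  | nil => simp [splitFirst]
  | cons a p => simp [splitFirst]

end splitFirst

section splitLast

variable {t s : A.Obj}

lemma splitLast_congr (p : BarWord A t s)
    {f f' : ∀ {y : A.Obj} {g : G}, BarWord A t y → A.grade s y g → V}
    (h : ∀ {y : A.Obj} {g : G} (q : BarWord A t y) (c : A.grade s y g),
      q.append (cons c nil) = p → f q c = f' q c) :
    p.splitLast f = p.splitLast f' := by
  induction p with
  | nil => rfl
  | cons a p ih =>
    cases p with
    | nil => exact h nil a rfl
    | cons e p => exact ih fun q c hq => h (cons a q) c (congrArg (cons a) hq)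

lemma splitLast_map {W : Type*} [AddCommGroup W] [Module k V] [Module k W] (φ : V →ₗ[k] W)
    (p : BarWord A t s)
    (f : ∀ {y : A.Obj} {g : G}, BarWord A t y → A.grade s y g → V) :
    φ (p.splitLast f) = p.splitLast fun q c => φ (f q c) := by
  induction p with
  | nil => exact map_zero φ
  | cons a p ih =>
    cases p with
    | nil => rfl
    | cons e p => exact ih _

lemma splitLast_add (p : BarWord A t s)
    (f f' : ∀ {y : A.Obj} {g : G}, BarWord A t y → A.grade s y g → V) :
    (p.splitLast fun q c => f q c + f' q c) = p.splitLast f + p.splitLast f' := by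
  induction p with
  | nil => exact (add_zero 0).symm
  | cons a p ih =>
    cases p with
    | nil => rfl
    | cons e p => exact ih _ _

lemma splitLast_smul [Module k V] (c : k) (p : BarWord A t s)
    (f : ∀ {y : A.Obj} {g : G}, BarWord A t y → A.grade s y g → V) :
    (p.splitLast fun q a => c • f q a) = c • p.splitLast f :=
  (splitLast_map (DistribSMul.toLinearMap k V c) p f).symm

lemma splitLast_append_cons {t y z s : A.Obj} {g : G} (q : BarWord A t y) (a : A.grade z y g)
    (r : BarWord A z s) (f : ∀ {y : A.Obj} {g : G}, BarWord A t y → A.grade s y g → V) :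
    (q.append (cons a r)).splitLast f
      = (cons a r).splitLast fun q' c => f (q.append q') c := by
  induction q with
  | nil => rfl
  | cons e q ih =>
    cases q with
    | nil => rfl
    | cons e' q => exact ih a _

lemma splitLast_sumSplits (p : BarWord A t s)
    (F : ∀ {x y : A.Obj} {g : G}, BarWord A t y → BarWord A y x → A.grade s x g → V) :
    (p.splitLast fun p' c => p'.sumSplits fun q r => F q r c)
      = p.sumSplits fun q r => r.splitLast fun r' c => F q r' c := by
  induction p with
  | nil => simp [splitLast]
  | cons a p ih =>
    cases p with
    | nil => simp [splitLast]
    | cons e p =>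
      rw [sumSplits_cons, ← ih]
      simp only [splitLast, sumSplits_cons a]
      exact splitLast_add ..

end splitLast

section barDiff

variable [Module k V] {t s : A.Obj}

lemma barDiff_congr (p : BarWord A t s) {f f' : BarWord A t s → V}
    (h : ∀ q : BarWord A t s, par q.deg = par p.deg + 1 → f q = f' q) :
    p.barDiff (k := k) f = p.barDiff f' := by
  induction p with
  | nil => rfl
  | cons a p ih =>
    rw [barDiff, barDiff, ih fun q hq => h (cons a q) (by simp only [par_deg_cons, hq]; ring),
      h (cons (A.hd a) p) (by simp only [par_deg_cons, par_add_one]; ring),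
      p.splitFirst_congr fun c q hq => h (cons (A.hcomp a c) q)
        (by simp only [← hq, par_deg_cons, par_add]; grind)]

lemma barDiff_map {W : Type*} [AddCommGroup W] [Module k W] (φ : V →ₗ[k] W) (p : BarWord A t s)
    (f : BarWord A t s → V) : φ (p.barDiff f) = p.barDiff fun q => φ (f q) := by
  induction p with
  | nil => exact map_zero φ
  | cons a p ih =>
    simp only [barDiff, map_add, map_smul, splitFirst_map, ih]

lemma barDiff_smul (c : k) (p : BarWord A t s) (f : BarWord A t s → V) :
    (p.barDiff fun q => c • f q) = c • p.barDiff f :=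
  (barDiff_map (DistribSMul.toLinearMap k V c) p f).symm

lemma barDiff_add (p : BarWord A t s) (f f' : BarWord A t s → V) :
    (p.barDiff (k := k) fun q => f q + f' q) = p.barDiff f + p.barDiff f' := by
  induction p with
  | nil => exact (add_zero 0).symm
  | cons a p ih => simp only [barDiff, ih, splitFirst_add]; module

lemma barDiff_sumSplits (p : BarWord A t s)
    (F : ∀ {y : A.Obj}, BarWord A t y → BarWord A y s → V) :
    (p.barDiff (k := k) fun p' => p'.sumSplits F)
      = p.sumSplits fun q r => (q.barDiff fun q' => F q' r)
          + sgn k (par q.deg) • r.barDiff fun r' => F q r' := by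
  induction p with
  | nil => simp [barDiff]
  | cons a p ih =>
    simp only [barDiff, sumSplits_cons, splitFirst_add, barDiff_add, ih, splitFirst_sumSplits,
      sumSplits_add, sumSplits_smul, par_deg_nil, par_deg_cons, sgn_add, sgn_zero, mul_smul]
    module

lemma barDiff_append_cons {t y z s : A.Obj} {g : G} (p : BarWord A t y) (a : A.grade z y g)
    (q : BarWord A z s) (f : BarWord A t s → V) :
    (p.append (cons a q)).barDiff f
      = (p.barDiff fun p' => f (p'.append (cons a q)))
        + (p.splitLast fun {_ h} p' c =>
            sgn k (par p'.deg + par h) • f (p'.append (cons (A.hcomp c a) q)))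
        + sgn k (par p.deg) • (f (p.append (cons (A.hd a) q))
          + sgn k (par g) • (q.splitFirst fun c q' => f (p.append (cons (A.hcomp a c) q')))
          + sgn k (par g + 1) • q.barDiff fun q' => f (p.append (cons a q'))) := by
  induction p with
  | nil => simp [barDiff, splitLast, par_deg_nil, sgn_zero]
  | cons e p ih =>
    rw [cons_append, barDiff, ih]
    cases p with
    | nil =>
      simp only [barDiff, splitLast, splitFirst, nil_append, cons_append, par_deg_nil,
        par_deg_cons, sgn_add, sgn_one, sgn_zero]
      module
    | cons e' p =>
      simp only [barDiff, splitLast, splitFirst, cons_append, par_deg_cons,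
        sgn_add, mul_smul, splitLast_smul]
      module

end barDiff
end BarWord

section operators

open BarWord

lemma zmodTwo_cases : ∀ p : ZMod 2, p = 0 ∨ p = 1 := by decide

lemma sumSplits_bPart {x y t : A.Obj} {g : G} (a₀ : A.grade x y g) (q₀ : BarWord A x t)
    (p : BarWord A t y) :
    (p.sumSplits fun q r => A.bPart a₀ (q₀.append q) r)
      = -((sgn k (par g + par q₀.deg) • p.barDiff fun p' => A.cls a₀ (q₀.append p'))
        + p.splitLast fun {_ h} q c =>
            sgn k ((par h + 1) * (par g + par q₀.deg + par q.deg))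
              • A.cls (A.hcomp c a₀) (q₀.append q)) := by
  induction p with
  | nil => simp [bPart, barDiff, splitLast]
  | cons a p ih =>
    have ih := ih a₀ (q₀.append (cons a nil))
    simp only [append_assoc, cons_append, nil_append, par_deg_append, par_deg_cons,
      par_deg_nil, add_zero] at ih
    rw [sumSplits_cons, ih, append_nil]
    cases p with
    | nil =>
      simp only [bPart, barDiff, splitFirst, splitLast, append_nil, par_deg_nil, sgn_add,
        sgn_one, add_zero]
      module
    | cons e p =>
      simp only [bPart, barDiff, splitFirst, splitLast, par_deg_cons, sgn_add, sgn_one,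
        add_assoc]
      module

lemma b_cls_eq {x y : A.Obj} {g : G} (a₀ : A.grade x y g) (p : BarWord A x y) :
    A.b (A.cls a₀ p) = A.cls (A.hd a₀) p
      + sgn k (par g) • (p.splitFirst fun c q => A.cls (A.hcomp a₀ c) q)
      - sgn k (par g) • (p.barDiff fun q => A.cls a₀ q)
      - p.splitLast fun {_ h} q c =>
          sgn k ((par h + 1) * (par g + par q.deg)) • A.cls (A.hcomp c a₀) q := by
  have hHead : A.bHead a₀ p = A.cls (A.hd a₀) p
      + sgn k (par g) • (p.splitFirst fun c q => A.cls (A.hcomp a₀ c) q) := by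
    cases p with
    | nil => simp [bHead, splitFirst]
    | cons a p => rfl
  have hPart := sumSplits_bPart a₀ nil p
  simp only [nil_append, par_deg_nil, add_zero] at hPart
  rw [b_cls, bWord, hHead, show (p.splits.map _).sum = _ from hPart]
  abel

lemma B_cls_eq {x y : A.Obj} {g : G} (a₀ : A.grade x y g) (p : BarWord A x y) :
    A.B (A.cls a₀ p) = p.sumSplits fun {t} q r =>
      sgn k ((par g + 1 + par q.deg) * par r.deg) • A.cls (A.hone t) (r.append (cons a₀ q)) :=
  A.B_cls a₀ p

lemma b_cls_hone {x : A.Obj} (p : BarWord A x x) :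
    A.b (A.cls (A.hone x) p)
      = (p.splitFirst fun c q => A.cls c q) - (p.barDiff fun q => A.cls (A.hone x) q)
        - p.splitLast fun {_ h} q c => sgn k ((par h + 1) * par q.deg) • A.cls c q := by
  simp only [b_cls_eq, par_zero, sgn_zero, one_smul, zero_add,
    cls_head_zero (a := A.hd (A.hone x)) (A.d_one x)]
  simp only [fun {y : A.Obj} {h : G} (c : A.grade y x h) (q : BarWord A y x) =>
      cls_congr (a := A.hcomp (A.hone x) c) (zero_add h) (A.one_comp _) q,
    fun {y : A.Obj} {h : G} (c : A.grade x y h) (q : BarWord A x y) =>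
      cls_congr (a := A.hcomp c (A.hone x)) (add_zero h) (A.comp_one _) q]

lemma B_splitFirst_cls {x y : A.Obj} {g : G} (a₀ : A.grade x y g) (p : BarWord A x y) :
    A.B (p.splitFirst fun c q => A.cls (A.hcomp a₀ c) q)
      = p.sumSplits fun {t} q r => sgn k ((par g + par q.deg) * par r.deg) •
          q.splitFirst fun c q' => A.cls (A.hone t) (r.append (cons (A.hcomp a₀ c) q')) := by
  simp only [splitFirst_map, B_cls_eq, splitFirst_sumSplits]
  refine sumSplits_congr p fun q r _ => ?_
  rw [← splitFirst_smul]
  refine splitFirst_congr q fun {_ h} c q' hq => ?_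
  rw [← hq, par_deg_cons, par_add]
  congr 2; ring

lemma B_barDiff_cls {x y : A.Obj} {g : G} (a₀ : A.grade x y g) (p : BarWord A x y) :
    A.B (p.barDiff fun q => A.cls a₀ q)
      = p.sumSplits fun {t} q r =>
          sgn k ((par g + par q.deg) * par r.deg) •
            (q.barDiff fun q' => A.cls (A.hone t) (r.append (cons a₀ q')))
          + sgn k (par q.deg + (par g + 1 + par q.deg) * (par r.deg + 1)) •
            r.barDiff fun r' => A.cls (A.hone t) (r'.append (cons a₀ q)) := by
  simp only [barDiff_map, B_cls_eq, barDiff_sumSplits]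
  refine sumSplits_congr p fun q r _ => ?_
  refine congrArg₂ (· + ·) ?_ ?_
  · rw [← barDiff_smul]
    refine barDiff_congr q fun q' hq' => ?_
    rw [hq']; congr 2; grind
  · rw [sgn_add, mul_smul]
    congr 1
    rw [← barDiff_smul]
    refine barDiff_congr r fun r' hr' => ?_
    rw [hr']

lemma B_splitLast_cls {x y : A.Obj} {g : G} (a₀ : A.grade x y g) (p : BarWord A x y) :
    A.B (p.splitLast fun {_ h} q c =>
        sgn k ((par h + 1) * (par g + par q.deg)) • A.cls (A.hcomp c a₀) q)
      = p.sumSplits fun {t} q r => sgn k ((par g + 1 + par q.deg) * par r.deg + 1) •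
          r.splitLast fun {_ h} r' c => sgn k (par r'.deg + par h) •
            A.cls (A.hone t) (r'.append (cons (A.hcomp c a₀) q)) := by
  trans p.splitLast fun {_ h} p' c => p'.sumSplits fun {t} q r =>
      sgn k ((par h + 1) * (par g + par q.deg + par r.deg)
        + (par h + par g + 1 + par q.deg) * par r.deg) •
        A.cls (A.hone t) (r.append (cons (A.hcomp c a₀) q))
  · rw [splitLast_map]
    refine splitLast_congr p fun p' c _ => ?_
    rw [map_smul, B_cls_eq, ← sumSplits_smul]
    refine sumSplits_congr p' fun q r hqr => ?_
    rw [smul_smul, ← sgn_add, ← hqr, par_deg_append, par_add, add_assoc (par g)]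
  rw [splitLast_sumSplits]
  refine sumSplits_congr p fun q r _ => ?_
  rw [← splitLast_smul]
  refine splitLast_congr r fun r' c hr => ?_
  rw [← hr, par_deg_append, par_deg_cons, par_deg_nil, smul_smul, ← sgn_add]
  congr 2; grind

lemma B_b_cls {x y : A.Obj} {g : G} (a₀ : A.grade x y g) (p : BarWord A x y) :
    A.B (A.b (A.cls a₀ p)) = p.sumSplits fun {t} q r =>
      sgn k ((par g + 1 + par q.deg) * par r.deg) •
        (r.append (cons a₀ q)).barDiff fun p' => A.cls (A.hone t) p' := by
  rw [b_cls_eq, map_sub, map_sub, map_add, map_smul, map_smul, B_splitFirst_cls, B_barDiff_cls,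
    B_splitLast_cls, B_cls_eq]
  simp only [← sumSplits_smul, ← sumSplits_add, ← sumSplits_sub]
  refine sumSplits_congr p fun q r _ => ?_
  rw [barDiff_append_cons, par_add_one, sgn_add, sgn_add, sgn_add (par g)]
  rcases zmodTwo_cases (par g) with hg | hg <;> rcases zmodTwo_cases (par q.deg) with hq | hq <;>
    rcases zmodTwo_cases (par r.deg) with hr | hr <;>
    simp only [hg, hq, hr, add_zero, zero_add, mul_zero, mul_one, one_mul,
      CharTwo.add_self_eq_zero, sgn_zero, sgn_one] <;>
    module

/-- The rotation `± c[r|a₀|q]` of the word `a₀[q|c|r]`. -/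
noncomputable def rotation {x y t z : A.Obj} {g h : G} (a₀ : A.grade x y g) (q : BarWord A x t)
    (c : A.grade z t h) (r : BarWord A z y) : A.NormChain :=
  sgn k ((par g + 1 + par q.deg) * (par h + 1 + par r.deg)) • A.cls c (r.append (cons a₀ q))

lemma sumSplits_splitFirst_eq {x y : A.Obj} {g : G} (a₀ : A.grade x y g) (p : BarWord A x y) :
    (p.sumSplits fun q r => sgn k ((par g + 1 + par q.deg) * par r.deg) •
        (r.append (cons a₀ q)).splitFirst fun c p' => A.cls c p')
      = A.cls a₀ p + p.sumLetters fun q c r => rotation a₀ q c r := by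
  rw [sumSplits_eq_add_sumLetters_right]
  simp only [rotation, splitFirst, nil_append, cons_append, par_deg_cons, par_deg_nil, mul_zero,
    sgn_zero, one_smul]

lemma sumSplits_splitLast_eq {x y : A.Obj} {g : G} (a₀ : A.grade x y g) (p : BarWord A x y) :
    (p.sumSplits fun q r => sgn k ((par g + 1 + par q.deg) * par r.deg) •
        (r.append (cons a₀ q)).splitLast fun {_ h} p' c =>
          sgn k ((par h + 1) * par p'.deg) • A.cls c p')
      = A.cls a₀ p + p.sumLetters fun q c r => rotation a₀ q c r := by
  rw [sumSplits_eq_add_sumLetters_left]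
  congr 1
  · simp only [splitLast_append_cons, splitLast, append_nil, smul_smul, ← sgn_add, par_deg_nil,
      add_zero, CharTwo.add_self_eq_zero, sgn_zero, one_smul]
  · congr! with t z h q c r
    rw [rotation, show cons a₀ (q.append (cons c nil)) = (cons a₀ q).append (cons c nil) from rfl,
      ← append_assoc, splitLast_append_cons, splitLast, append_nil, smul_smul, ← sgn_add]
    simp only [par_deg_append, par_deg_cons, par_deg_nil]
    congr 2
    grind

lemma b_B_cls {x y : A.Obj} {g : G} (a₀ : A.grade x y g) (p : BarWord A x y) :
    A.b (A.B (A.cls a₀ p)) = -A.B (A.b (A.cls a₀ p)) := by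
  rw [B_b_cls, B_cls_eq, sumSplits_map]
  simp only [map_smul, b_cls_hone, smul_sub, sumSplits_sub, sumSplits_splitFirst_eq,
    sumSplits_splitLast_eq]
  abel

lemma B_cls_hone {x : A.Obj} (p : BarWord A x x) : A.B (A.cls (A.hone x) p) = 0 := by
  rw [B_cls_eq]
  exact sumSplits_eq_zero p fun q r => by rw [cls_unit, smul_zero]

lemma linearMap_ext_cls {V : Type*} [AddCommGroup V] [Module k V] {φ ψ : A.NormChain →ₗ[k] V}
    (h : ∀ {x y : A.Obj} {g : G} (a₀ : A.grade x y g) (p : BarWord A x y),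
      φ (A.cls a₀ p) = ψ (A.cls a₀ p)) : φ = ψ :=
  Submodule.linearMap_qext _ <| Finsupp.lhom_ext' fun c => LinearMap.ext_ring <| h c.head c.tail

variable (A)

theorem b_comp_B : A.b ∘ₗ A.B = -(A.B ∘ₗ A.b) := linearMap_ext_cls b_B_cls

theorem B_comp_B : A.B ∘ₗ A.B = 0 := linearMap_ext_cls fun a₀ p => by
  rw [LinearMap.comp_apply, B_cls_eq, sumSplits_map]
  exact sumSplits_eq_zero p fun q r => by rw [map_smul, B_cls_hone, smul_zero]

end operators

section isLin

variable {M V : Type*} [AddCommGroup M] [Module k M] [AddCommGroup V] [Module k V] {f : M → V}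

lemma IsLin.map_zero (hf : IsLin (k := k) f) : f 0 = 0 := by
  simpa using hf 1 0 0

lemma IsLin.map_smul (hf : IsLin (k := k) f) (c : k) (a : M) : f (c • a) = c • f a := by
  simpa [hf.map_zero] using hf c a 0

lemma IsLin.map_sub (hf : IsLin (k := k) f) (a a' : M) : f (a - a') = f a - f a' := by
  simpa [neg_add_eq_sub] using hf (-1) a' a

lemma IsLin.map_sum (hf : IsLin (k := k) f) {ι : Type*} (s : Finset ι) (a : ι → M) :
    f (∑ i ∈ s, a i) = ∑ i ∈ s, f (a i) := by
  induction s using Finset.cons_induction with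
  | empty => simp [hf.map_zero]
  | cons i s hi ih => simpa [ih] using hf 1 (a i) (∑ i ∈ s, a i)

end isLin

section degrees

lemma cls_mem_chainDeg {x y : A.Obj} {g e : G} (a₀ : A.grade x y g) (p : BarWord A x y)
    (h : g + p.deg = e) : A.cls a₀ p ∈ A.chainDeg e :=
  Submodule.subset_span ⟨⟨a₀, p⟩, h, rfl⟩

lemma map_mem_chainDeg {A' : DGCategory.{u', v'} k G} {φ : A.NormChain →ₗ[k] A'.NormChain} {e : G}
    (hφ : ∀ {x y : A.Obj} {g : G} (a₀ : A.grade x y g) (p : BarWord A x y),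
      φ (A.cls a₀ p) ∈ A'.chainDeg (g + p.deg + e)) {g : G} {z : A.NormChain}
    (hz : z ∈ A.chainDeg g) : φ z ∈ A'.chainDeg (g + e) := by
  induction hz using Submodule.span_induction with
  | mem z hz => obtain ⟨c, rfl, rfl⟩ := hz; exact hφ c.head c.tail
  | zero => exact map_zero φ ▸ zero_mem _
  | add z z' _ _ hz hz' => exact map_add φ z z' ▸ add_mem hz hz'
  | smul c z _ hz => exact map_smul φ c z ▸ Submodule.smul_mem _ c hz

lemma BarWord.sumSplits_mem {V : Type*} [AddCommGroup V] [Module k V] {t s : A.Obj}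
    (S : Submodule k V) (p : BarWord A t s)
    {F : ∀ {y : A.Obj}, BarWord A t y → BarWord A y s → V}
    (h : ∀ {y : A.Obj} (q : BarWord A t y) (r : BarWord A y s), q.append r = p → F q r ∈ S) :
    p.sumSplits F ∈ S := by
  induction p with
  | nil => simpa using h nil nil rfl
  | cons a p ih =>
    rw [sumSplits_cons]
    exact add_mem (h nil _ rfl) (ih fun q r hqr => h (cons a q) r (congrArg (cons a) hqr))

lemma B_mem_chainDeg {g : G} {z : A.NormChain} (hz : z ∈ A.chainDeg g) :
    A.B z ∈ A.chainDeg (g - 1) := by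
  rw [sub_eq_add_neg]
  refine map_mem_chainDeg (fun {x y g} a₀ p => ?_) hz
  rw [B_cls_eq]
  refine p.sumSplits_mem _ fun q r hqr => Submodule.smul_mem _ _ (cls_mem_chainDeg _ _ ?_)
  rw [← hqr, BarWord.deg_append, BarWord.deg, BarWord.deg_append]
  abel

end degrees

/-- A decomposition of every identity of `A` through a fixed finite family of objects `mid i`:
closed morphisms `incl x i : mid i → x` and `proj x i : x → mid i` of degree `0` with
`∑ i, incl x i ∘ proj x i = 1`. It plays the role of a separability idempotent. -/
structure IdentityDecomposition (A : DGCategory.{u, v} k G) (ι : Type*) [Fintype ι] where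
  mid : ι → A.Obj
  incl : ∀ (x : A.Obj) (i : ι), A.grade (mid i) x (0 : G)
  proj : ∀ (x : A.Obj) (i : ι), A.grade x (mid i) (0 : G)
  d_incl : ∀ x i, A.d (mid i) x (incl x i) = 0
  d_proj : ∀ x i, A.d x (mid i) (proj x i) = 0
  sum_incl_proj : ∀ x, ∑ i, A.comp (incl x i : A.Hom (mid i) x) (proj x i : A.Hom x (mid i))
    = A.one x

namespace IdentityDecomposition

variable {ι : Type*} [Fintype ι] (D : IdentityDecomposition A ι)

/-- Homogeneous morphisms of degree `0` that act on the summands of a decomposition by scalars. -/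
def IsDiagonal {x y : A.Obj} {g : G} (a : A.grade x y g) : Prop :=
  g = 0 ∧ ∃ c : ι → k, ∀ i,
    A.comp (a : A.Hom x y) (D.incl x i : A.Hom (D.mid i) x) = c i • (D.incl y i : A.Hom _ _) ∧
    A.comp (D.proj y i : A.Hom y (D.mid i)) (a : A.Hom x y) = c i • (D.proj x i : A.Hom _ _)

section IsDiagonal

variable {D} {x y z : A.Obj} {g h : G}

lemma isDiagonal_hone (x : A.Obj) : D.IsDiagonal (A.hone x) :=
  ⟨rfl, 1, fun i => by simp [hone, A.one_comp, A.comp_one]⟩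

lemma IsDiagonal.hcomp {a : A.grade y z g} {a' : A.grade x y h} (ha : D.IsDiagonal a)
    (ha' : D.IsDiagonal a') : D.IsDiagonal (A.hcomp a a') := by
  obtain ⟨rfl, c, hc⟩ := ha
  obtain ⟨rfl, c', hc'⟩ := ha'
  refine ⟨add_zero 0, c * c', fun i => ⟨?_, ?_⟩⟩
  · simp only [DGCategory.hcomp, A.comp_assoc, hc', hc, map_smul, Pi.mul_apply, mul_smul]
    exact smul_comm ..
  · simp only [DGCategory.hcomp, ← A.comp_assoc, hc, hc', map_smul, LinearMap.smul_apply,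
      Pi.mul_apply, mul_smul]

lemma IsDiagonal.smul (r : k) {a : A.grade x y g} (ha : D.IsDiagonal a) :
    D.IsDiagonal (r • a) := by
  obtain ⟨rfl, c, hc⟩ := ha
  exact ⟨rfl, r • c, fun i => by simp [hc, mul_smul]⟩

lemma IsDiagonal.sub {a a' : A.grade x y g} (ha : D.IsDiagonal a) (ha' : D.IsDiagonal a') :
    D.IsDiagonal (a - a') := by
  obtain ⟨rfl, c, hc⟩ := ha
  obtain ⟨-, c', hc'⟩ := ha'
  exact ⟨rfl, c - c', fun i => by simp [hc, hc', sub_smul]⟩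

end IsDiagonal

/-- The operation `a₀[p] ↦ ± (a₀ ∘ incl i)[proj i|p]` inserting the `i`-th summand. -/
noncomputable def insertion (i : ι) : A.NormChain →ₗ[k] A.NormChain :=
  A.relSubmodule.liftQ (Finsupp.linearCombination k fun c : HWord A => sgn k (par c.g) •
      A.cls (A.hcomp c.head (D.incl c.dom i)) (.cons (D.proj c.dom i) c.tail)) <|
    relSubmodule_le_ker
      (fun {x _ g} a₀ p =>
        sgn k (par g) • A.cls (A.hcomp a₀ (D.incl x i)) (.cons (D.proj x i) p))
      (fun p => ((isLin_cls_head _).comp' (isLin_hcomp_left _)).smul _)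
      (fun a₀ q r c a a' => by
        simp only [← BarWord.cons_append, isLin_cls_tail _ _ r c a a']
        module)
      (fun a₀ q r => by simp only [← BarWord.cons_append, cls_unit, smul_zero])

lemma insertion_cls (i : ι) {x y : A.Obj} {g : G} (a₀ : A.grade x y g) (p : BarWord A x y) :
    D.insertion i (A.cls a₀ p)
      = sgn k (par g) • A.cls (A.hcomp a₀ (D.incl x i)) (.cons (D.proj x i) p) := by
  simp [insertion, cls]

lemma insertion_mem_chainDeg (i : ι) {g : G} {z : A.NormChain} (hz : z ∈ A.chainDeg g) :
    D.insertion i z ∈ A.chainDeg (g - 1) := by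
  rw [sub_eq_add_neg]
  refine map_mem_chainDeg (fun a₀ p => ?_) hz
  rw [insertion_cls]
  refine Submodule.smul_mem _ _ (cls_mem_chainDeg _ _ ?_)
  rw [BarWord.deg]
  abel

/-- The contraction `a₀[p] ↦ ± ∑ i, (a₀ ∘ incl i)[proj i|p]` of the bar words whose first letter
is diagonal. -/
noncomputable def contraction : A.NormChain →ₗ[k] A.NormChain := ∑ i, D.insertion i

lemma contraction_mem_chainDeg {g : G} {z : A.NormChain} (hz : z ∈ A.chainDeg g) :
    D.contraction z ∈ A.chainDeg (g - 1) := by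
  rw [contraction, LinearMap.sum_apply]
  exact sum_mem fun i _ => D.insertion_mem_chainDeg i hz

section homotopy

variable {D} {x y z : A.Obj} {g h : G}

lemma b_cls_hcomp_incl_cons_proj (i : ι) (a₀ : A.grade x y g) (c : A.grade z x h)
    (p : BarWord A z y) :
    A.b (A.cls (A.hcomp a₀ (D.incl x i)) (.cons (D.proj x i) (.cons c p)))
      = A.cls (A.hcomp (A.hd a₀) (D.incl x i)) (.cons (D.proj x i) (.cons c p))
        + sgn k (par g) • A.cls (A.hcomp (A.hcomp a₀ (D.incl x i)) (D.proj x i)) (.cons c p)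
        - sgn k (par g) • A.cls (A.hcomp a₀ (D.incl x i)) (.cons (A.hcomp (D.proj x i) c) p)
        + sgn k (par g) • ((BarWord.cons c p).barDiff fun q =>
            A.cls (A.hcomp a₀ (D.incl x i)) (.cons (D.proj x i) q))
        - (BarWord.cons c p).splitLast fun {_ h} q e =>
            sgn k ((par h + 1) * (par g + par q.deg + 1)) •
              A.cls (A.hcomp (A.hcomp e a₀) (D.incl x i)) (.cons (D.proj x i) q) := by
  have hd_head : A.cls (A.hd (A.hcomp a₀ (D.incl x i))) (.cons (D.proj x i) (.cons c p))
      = A.cls (A.hcomp (A.hd a₀) (D.incl x i)) (.cons (D.proj x i) (.cons c p)) :=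
    cls_congr (by abel) (by simp [hd, DGCategory.hcomp, A.d_comp a₀.2, D.d_incl]) _
  have hd_proj : A.cls (A.hcomp a₀ (D.incl x i)) (.cons (A.hd (D.proj x i)) (.cons c p)) = 0 :=
    cls_tail_zero (A.hcomp a₀ (D.incl x i)) (D.d_proj x i) .nil (.cons c p)
  rw [b_cls_eq, hd_head, BarWord.barDiff, hd_proj, BarWord.splitFirst, BarWord.splitFirst,
    BarWord.splitLast]
  refine congrArg₂ (· - ·) ?_ (BarWord.splitLast_congr _ fun {_ h} q e _ => ?_)
  · simp only [par_zero, sgn_add, sgn_zero, sgn_one, add_zero]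
    module
  · rw [BarWord.par_deg_cons, par_add, par_zero,
      cls_congr (a' := A.hcomp (A.hcomp e a₀) (D.incl x i)) (add_assoc h g 0).symm
        (A.comp_assoc _ _ _).symm]
    congr 2; ring

lemma b_insertion_cls_cons (i : ι) (a₀ : A.grade x y g) (c : A.grade z x h) (p : BarWord A z y) :
    A.b (D.insertion i (A.cls a₀ (.cons c p))) + D.insertion i (A.b (A.cls a₀ (.cons c p)))
      = A.cls (A.hcomp (A.hcomp a₀ (D.incl x i)) (D.proj x i)) (.cons c p)
        + sgn k (par h) • A.cls (A.hcomp (A.hcomp a₀ c) (D.incl z i)) (.cons (D.proj z i) p)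
        - A.cls (A.hcomp a₀ (D.incl x i)) (.cons (A.hcomp (D.proj x i) c) p) := by
  have hlast : D.insertion i ((BarWord.cons c p).splitLast fun {_ h} q e =>
        sgn k ((par h + 1) * (par g + par q.deg)) • A.cls (A.hcomp e a₀) q)
      = -sgn k (par g) • (BarWord.cons c p).splitLast fun {_ h} q e =>
            sgn k ((par h + 1) * (par g + par q.deg + 1)) •
              A.cls (A.hcomp (A.hcomp e a₀) (D.incl x i)) (.cons (D.proj x i) q) := by
    rw [BarWord.splitLast_map, ← BarWord.splitLast_smul]
    refine BarWord.splitLast_congr _ fun q e _ => ?_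
    rw [map_smul, insertion_cls, smul_smul, smul_smul, par_add, mul_add_one]
    simp only [sgn_add, sgn_one]
    congr 1; ring
  have hdiff : D.insertion i ((BarWord.cons c p).barDiff fun q => A.cls a₀ q)
      = sgn k (par g) • (BarWord.cons c p).barDiff fun q =>
          A.cls (A.hcomp a₀ (D.incl x i)) (.cons (D.proj x i) q) := by
    simp only [BarWord.barDiff_map, insertion_cls, BarWord.barDiff_smul]
  rw [b_cls_eq, map_sub, map_sub, map_add, map_smul, map_smul, hlast, hdiff, BarWord.splitFirst]
  simp only [map_smul, insertion_cls, b_cls_hcomp_incl_cons_proj, par_add g h, par_add_one]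
  rcases zmodTwo_cases (par g) with hg | hg <;>
    simp only [hg, sgn_add, sgn_zero, sgn_one] <;> module

lemma b_insertion_cls_cons_of_isDiagonal (i : ι) (a₀ : A.grade x y g) {c : A.grade z x h}
    (hc : D.IsDiagonal c) (p : BarWord A z y) :
    A.b (D.insertion i (A.cls a₀ (.cons c p))) + D.insertion i (A.b (A.cls a₀ (.cons c p)))
      = A.cls (A.hcomp (A.hcomp a₀ (D.incl x i)) (D.proj x i)) (.cons c p) := by
  rw [b_insertion_cls_cons]
  obtain ⟨rfl, r, hr⟩ := hc
  have hleft : A.cls (A.hcomp (A.hcomp a₀ c) (D.incl z i)) (.cons (D.proj z i) p)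
      = r i • A.cls (A.hcomp a₀ (D.incl x i)) (.cons (D.proj z i) p) := by
    rw [← (isLin_cls_head _).map_smul]
    refine cls_congr (by simp) ?_ _
    simp [DGCategory.hcomp, A.comp_assoc, hr]
  have hright : A.cls (A.hcomp a₀ (D.incl x i)) (.cons (A.hcomp (D.proj x i) c) p)
      = r i • A.cls (A.hcomp a₀ (D.incl x i)) (.cons (D.proj z i) p) := by
    refine .trans ?_ ((isLin_cls_tail _ .nil p).map_smul (r i) (D.proj z i))
    refine cls_tail_congr (q := .nil) _ (zero_add 0) ?_ p
    simp [DGCategory.hcomp, hr]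
  rw [hleft, hright, par_zero, sgn_zero]
  module

lemma b_contraction_add (a₀ : A.grade x y g) {c : A.grade z x h} (hc : D.IsDiagonal c)
    (p : BarWord A z y) :
    A.b (D.contraction (A.cls a₀ (.cons c p))) + D.contraction (A.b (A.cls a₀ (.cons c p)))
      = A.cls a₀ (.cons c p) := by
  have hsum : ∑ i, (⟨A.comp (D.incl x i : A.Hom (D.mid i) x) (D.proj x i : A.Hom x (D.mid i)),
      A.comp_mem_zero (D.incl x i).2 (D.proj x i).2⟩ : A.grade x x 0) = A.hone x := by
    ext; simp [hone, D.sum_incl_proj]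
  simp only [contraction, LinearMap.sum_apply, map_sum, ← Finset.sum_add_distrib,
    b_insertion_cls_cons_of_isDiagonal _ a₀ hc p]
  calc
    _ = ∑ i, A.cls (A.hcomp a₀ ⟨_, A.comp_mem_zero (D.incl x i).2 (D.proj x i).2⟩) (.cons c p) :=
      Finset.sum_congr rfl fun i _ => cls_congr (by simp) (A.comp_assoc _ _ _) _
    _ = A.cls (A.hcomp a₀ (A.hone x)) (.cons c p) := by
      rw [← hsum, ((isLin_cls_head _).comp' (isLin_hcomp_right a₀)).map_sum]
    _ = A.cls a₀ (.cons c p) := cls_congr (add_zero g) (A.comp_one _) _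

end homotopy

section diagonalChains

/-- Bar words all of whose letters are diagonal. -/
def IsDiagonalWord : ∀ {x y : A.Obj}, BarWord A x y → Prop
  | _, _, .nil => True
  | _, _, .cons a p => D.IsDiagonal a ∧ IsDiagonalWord p

/-- The span of the words `a₀[a₁|⋯|aₙ]`, `n ≥ 1`, with diagonal letters: the chains on which
`contraction` is a contracting homotopy. -/
noncomputable def diagonalChains : Submodule k A.NormChain :=
  Submodule.span k {z | ∃ (x y t : A.Obj) (g h : G) (a₀ : A.grade x y g) (c : A.grade t x h)
    (p : BarWord A t y), D.IsDiagonal a₀ ∧ D.IsDiagonalWord (.cons c p) ∧ z = A.cls a₀ (.cons c p)}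

variable {D} {x y t : A.Obj} {g h : G}

lemma isDiagonalWord_append {p : BarWord A x t} {q : BarWord A t y} :
    D.IsDiagonalWord (p.append q) ↔ D.IsDiagonalWord p ∧ D.IsDiagonalWord q := by
  induction p with
  | nil => simp [IsDiagonalWord]
  | cons a p ih => simp [IsDiagonalWord, ih, and_assoc]

lemma cls_mem_diagonalChains {a₀ : A.grade x y g} {c : A.grade t x h} {p : BarWord A t y}
    (ha₀ : D.IsDiagonal a₀) (hp : D.IsDiagonalWord (.cons c p)) :
    A.cls a₀ (.cons c p) ∈ D.diagonalChains :=
  Submodule.subset_span ⟨_, _, _, _, _, _, _, _, ha₀, hp, rfl⟩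

lemma cls_append_mem_diagonalChains {z s : A.Obj} {a₀ : A.grade s z g} {q : BarWord A s x}
    {c : A.grade t x h} {r : BarWord A t z} (ha₀ : D.IsDiagonal a₀)
    (hq : D.IsDiagonalWord q) (hr : D.IsDiagonalWord (.cons c r)) :
    A.cls a₀ (q.append (.cons c r)) ∈ D.diagonalChains := by
  cases q with
  | nil => exact cls_mem_diagonalChains ha₀ hr
  | cons e q => exact cls_mem_diagonalChains ha₀ (isDiagonalWord_append.2 ⟨hq, hr⟩)

lemma B_mem_diagonalChains {z : A.NormChain} (hz : z ∈ D.diagonalChains) :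
    A.B z ∈ D.diagonalChains := by
  refine (Submodule.span_le (p := D.diagonalChains.comap A.B)).2 ?_ hz
  rintro _ ⟨x, y, t, g, h, a₀, c, p, ha₀, hp, rfl⟩
  rw [SetLike.mem_coe, Submodule.mem_comap, B_cls_eq]
  refine BarWord.sumSplits_mem _ _ fun q r hqr => Submodule.smul_mem _ _ ?_
  rw [← hqr, isDiagonalWord_append] at hp
  exact cls_append_mem_diagonalChains (isDiagonal_hone _) hp.2 ⟨ha₀, hp.1⟩

lemma contraction_mem_diagonalChains (hincl : ∀ x i, D.IsDiagonal (D.incl x i))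
    (hproj : ∀ x i, D.IsDiagonal (D.proj x i)) {z : A.NormChain} (hz : z ∈ D.diagonalChains) :
    D.contraction z ∈ D.diagonalChains := by
  refine (Submodule.span_le (p := D.diagonalChains.comap D.contraction)).2 ?_ hz
  rintro _ ⟨x, y, t, g, h, a₀, c, p, ha₀, hp, rfl⟩
  rw [SetLike.mem_coe, Submodule.mem_comap, contraction, LinearMap.sum_apply]
  refine sum_mem fun i _ => ?_
  rw [insertion_cls]
  exact Submodule.smul_mem _ _ (cls_mem_diagonalChains (ha₀.hcomp (hincl x i)) ⟨hproj x i, hp⟩)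

theorem b_contraction_add_of_mem {z : A.NormChain} (hz : z ∈ D.diagonalChains) :
    A.b (D.contraction z) + D.contraction (A.b z) = z := by
  refine LinearMap.eqOn_span (f := A.b ∘ₗ D.contraction + D.contraction ∘ₗ A.b) (g := .id) ?_ hz
  rintro _ ⟨x, y, t, g, h, a₀, c, p, -, hp, rfl⟩
  exact b_contraction_add a₀ hp.1 p

end diagonalChains

end IdentityDecomposition

section lifting

lemma negDiff_zero (z : A.NegChain) : A.negDiff z 0 = A.b (z 0) := add_zero (A.b (z 0))

lemma negDiff_succ (z : A.NegChain) (m : ℕ) :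
    A.negDiff z (m + 1) = A.b (z (m + 1)) + A.B (z m) := rfl

lemma mem_negDeg {g : G} {z : A.NegChain} :
    z ∈ A.negDeg g ↔ ∀ m : ℕ, z m ∈ A.chainDeg (g - ((2 * m : ℕ) : G)) := by
  simp [negDeg, Submodule.mem_pi]

lemma b_B (z : A.NormChain) : A.b (A.B z) = -A.B (A.b z) := LinearMap.congr_fun A.b_comp_B z

lemma B_B (z : A.NormChain) : A.B (A.B z) = 0 := LinearMap.congr_fun A.B_comp_B z

lemma B_negDiff (z : A.NegChain) (m : ℕ) : A.B (A.negDiff z m) = A.B (A.b (z m)) := by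
  cases m with
  | zero => rw [negDiff_zero]
  | succ m => rw [negDiff_succ, map_add, B_B, add_zero]

lemma b_sub_B_eq_zero {ζ w : A.NegChain} (hζ : A.negDiff ζ = 0) {m : ℕ}
    (hw : A.negDiff w m = ζ m) : A.b (ζ (m + 1) - A.B (w m)) = 0 := by
  rw [map_sub, b_B, ← B_negDiff, hw, sub_neg_eq_add, ← negDiff_succ, hζ, Pi.zero_apply]

variable {g : G} {S : Submodule k A.NormChain} {h : A.NormChain →ₗ[k] A.NormChain}

/-- The extension of `w₀` to a solution `w` of `(b + u B) w = ζ` along a contraction `h` of `b`. -/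
noncomputable def liftAlong (h : A.NormChain →ₗ[k] A.NormChain) (ζ : A.NegChain)
    (w₀ : A.NormChain) : A.NegChain
  | 0 => w₀
  | m + 1 => h (ζ (m + 1) - A.B (liftAlong h ζ w₀ m))

lemma liftAlong_mem {ζ : A.NegChain} {w₀ : A.NormChain} (hBS : ∀ z ∈ S, A.B z ∈ S)
    (hhS : ∀ z ∈ S, h z ∈ S) (hζ : ∀ m, ζ (m + 1) ∈ S) (hw₀ : w₀ ∈ S) (m : ℕ) :
    liftAlong h ζ w₀ m ∈ S := by
  induction m with
  | zero => exact hw₀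
  | succ m ih => exact hhS _ (sub_mem (hζ m) (hBS _ ih))

lemma liftAlong_mem_negDeg {ζ : A.NegChain} {w₀ : A.NormChain}
    (hh : ∀ {g : G} {z : A.NormChain}, z ∈ A.chainDeg g → h z ∈ A.chainDeg (g - 1))
    (hζ : ζ ∈ A.negDeg g) (hw₀ : w₀ ∈ A.chainDeg (g - 1)) :
    liftAlong h ζ w₀ ∈ A.negDeg (g - 1) := by
  rw [mem_negDeg] at hζ ⊢
  intro m
  induction m with
  | zero => simpa [liftAlong] using hw₀
  | succ m ih =>
    have hB := B_mem_chainDeg ih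
    rw [show g - 1 - ((2 * m : ℕ) : G) - 1 = g - ((2 * (m + 1) : ℕ) : G) by
      rw [Nat.mul_succ, Nat.cast_succ, Nat.cast_succ]; abel] at hB
    rw [sub_right_comm]
    exact hh (sub_mem (hζ (m + 1)) hB)

lemma negDiff_liftAlong {ζ : A.NegChain} {w₀ : A.NormChain} (hBS : ∀ z ∈ S, A.B z ∈ S)
    (hhS : ∀ z ∈ S, h z ∈ S) (hbh : ∀ z ∈ S, A.b (h z) + h (A.b z) = z)
    (hζ : A.negDiff ζ = 0) (hζS : ∀ m, ζ (m + 1) ∈ S) (hw₀S : w₀ ∈ S) (hw₀ : A.b w₀ = ζ 0) :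
    A.negDiff (liftAlong h ζ w₀) = ζ := by
  funext m
  induction m with
  | zero => rw [negDiff_zero, liftAlong, hw₀]
  | succ m ih =>
    have hcontr := hbh _ (sub_mem (hζS m) (hBS _ (liftAlong_mem hBS hhS hζS hw₀S m)))
    rw [b_sub_B_eq_zero hζ ih, map_zero, add_zero] at hcontr
    rw [negDiff_succ, liftAlong, hcontr, sub_add_cancel]

end lifting

section eta

open BarWord

variable {N : A.Obj} {π : A.grade N N (0 : G)} {V : Type*} [AddCommGroup V]

lemma par_deg_rep (n : ℕ) : par (rep π n).deg = n := by
  induction n with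
  | zero => exact par_deg_nil
  | succ n ih => rw [rep, par_deg_cons, ih, par_zero, Nat.cast_succ]; ring

lemma deg_rep (n : ℕ) : (rep π n).deg = -(n : G) := by
  induction n with
  | zero => simp [rep, deg]
  | succ n ih => rw [rep, deg, ih, Nat.cast_succ]; abel

lemma rep_append_rep (m n : ℕ) : (rep π m).append (rep π n) = rep π (m + n) := by
  induction m with
  | zero => rw [rep, nil_append, zero_add]
  | succ m ih => rw [rep, cons_append, ih, Nat.succ_add, rep]

lemma splitLast_rep (n : ℕ)
    (f : ∀ {y : A.Obj} {g : G}, BarWord A N y → A.grade N y g → V) :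
    (rep π (n + 1)).splitLast f = f (rep π n) π := by
  induction n generalizing f with
  | zero => rfl
  | succ _ ih => exact ih fun q c => f (cons π q) c

lemma sumSplits_rep (n : ℕ) {F : ∀ {y : A.Obj}, BarWord A N y → BarWord A y N → V} {v : V}
    (h : ∀ i j, i + j = n → F (rep π i) (rep π j) = v) : (rep π n).sumSplits F = (n + 1) • v := by
  induction n generalizing F with
  | zero => simpa [rep] using h 0 0 rfl
  | succ n ih =>
    rw [rep, sumSplits_cons, ih fun i j hij => h (i + 1) j (by lia), succ_nsmul' _ (n + 1)]
    exact congrArg (· + _) (h 0 (n + 1) (zero_add _))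

lemma barDiff_rep_cls (hdπ : A.d N N π = 0)
    (hπ : A.comp (π : A.Hom N N) (π : A.Hom N N) = π) {x : A.Obj} {g : G} (a₀ : A.grade x N g)
    (q : BarWord A x N) (n : ℕ) :
    ((rep π (n + 1)).barDiff fun p => A.cls a₀ (q.append p))
      = if Odd n then A.cls a₀ (q.append (rep π n)) else 0 := by
  induction n generalizing q with
  | zero =>
    simp [rep, barDiff, splitFirst, cls_tail_zero a₀ (a := A.hd π) hdπ q nil]
  | succ n ih =>
    have hd := cls_tail_zero a₀ (a := A.hd π) hdπ q (rep π (n + 1))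
    have hmul := cls_tail_congr a₀ (add_zero (0 : G)) (a := A.hcomp π π) hπ q (rep π n)
    have ih := ih (q.append (cons π nil))
    simp only [append_assoc, cons_append, nil_append] at ih
    rw [rep, barDiff, hd, rep, splitFirst, hmul, ← rep, ih]
    by_cases hn : Odd n <;> simp [hn, Nat.odd_add_one, rep, par_zero, sgn_zero, sgn_one]

lemma cls_two_smul_sub_hone (p : BarWord A N N) :
    A.cls ((2 : k) • π - A.hone N) p = (2 : k) • A.cls π p - A.cls (A.hone N) p := by
  rw [(isLin_cls_head p).map_sub, (isLin_cls_head p).map_smul]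

lemma b_cls_two_smul_sub_hone_rep (hdπ : A.d N N π = 0)
    (hπ : A.comp (π : A.Hom N N) (π : A.Hom N N) = π) (m : ℕ) :
    A.b (A.cls ((2 : k) • π - A.hone N) (rep π (2 * (m + 1))))
      = A.cls (A.hone N) (rep π (2 * m + 1)) := by
  set ε := (2 : k) • π - A.hone N
  have hdε : A.cls (A.hd ε) (rep π (2 * (m + 1))) = 0 :=
    cls_head_zero (by simp [ε, hd, hone, hdπ, A.d_one]) _
  have hεπ : A.cls (A.hcomp ε π) (rep π (2 * m + 1)) = A.cls π (rep π (2 * m + 1)) :=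
    cls_congr (add_zero 0) (by simp [ε, hcomp, hone, hπ, A.one_comp, two_smul]) _
  have hπε : A.cls (A.hcomp π ε) (rep π (2 * m + 1)) = A.cls π (rep π (2 * m + 1)) :=
    cls_congr (add_zero 0) (by simp [ε, hcomp, hone, hπ, A.comp_one, two_smul]) _
  have hbar := barDiff_rep_cls hdπ hπ ε nil (2 * m + 1)
  simp only [nil_append, odd_two_mul_add_one, if_true] at hbar
  have hcard : (par (0 : G) + 1) * (par (0 : G) + (2 * m + 1 : ℕ)) = 1 := by
    rw [par_zero, Nat.cast_succ, Nat.cast_mul]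
    exact congrArg (fun t => _ * (_ + (t + 1))) (zero_mul _)
  rw [b_cls_eq, hdε, show 2 * (m + 1) = 2 * m + 1 + 1 by ring, hbar, splitLast_rep,
    show rep π (2 * m + 1 + 1) = cons π (rep π (2 * m + 1)) from rfl, splitFirst, hεπ, hπε,
    par_deg_rep, hcard, cls_two_smul_sub_hone]
  rw [par_zero, sgn_zero, sgn_one]
  module

lemma B_cls_rep (m : ℕ) :
    A.B (A.cls π (rep π (2 * m))) = (2 * m + 1) • A.cls (A.hone N) (rep π (2 * m + 1)) := by
  rw [B_cls_eq]
  refine sumSplits_rep _ fun i j hij => ?_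
  have hsign : (par (0 : G) + 1 + i) * (j : ZMod 2) = 0 := by
    have hij : (i : ZMod 2) + j = 0 := by
      rw [← Nat.cast_add, hij, Nat.cast_mul]; exact zero_mul _
    rw [par_zero]
    generalize (i : ZMod 2) = s at *
    generalize (j : ZMod 2) = t at *
    revert s t; decide
  rw [par_deg_rep, par_deg_rep, hsign, sgn_zero, one_smul, ← rep, rep_append_rep]
  congr 2; lia

lemma B_cls_two_smul_sub_hone_rep (m : ℕ) :
    A.B (A.cls ((2 : k) • π - A.hone N) (rep π (2 * m)))
      = (2 * (2 * m + 1) : k) • A.cls (A.hone N) (rep π (2 * m + 1)) := by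
  rw [cls_two_smul_sub_hone, map_sub, map_smul, B_cls_hone, B_cls_rep]
  module

lemma factorial_div_succ (m : ℕ) :
    (2 * (m + 2)).factorial / (2 * (m + 2).factorial)
      = 2 * (2 * (m + 1) + 1) * ((2 * (m + 1)).factorial / (2 * (m + 1).factorial)) := by
  refine Nat.div_eq_of_eq_mul_left (by positivity) ?_
  have h := Nat.div_mul_cancel (two_mul_factorial_dvd m)
  rw [show 2 * (m + 2) = 2 * (m + 1) + 1 + 1 by ring, Nat.factorial_succ, Nat.factorial_succ,
    Nat.factorial_succ (m + 1)]
  nth_rw 1 [← h]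
  ring

theorem negDiff_eta (hdπ : A.d N N π = 0)
    (hπ : A.comp (π : A.Hom N N) (π : A.Hom N N) = π) : A.negDiff (A.eta N π) = 0 := by
  funext m
  rcases m with _ | _ | m
  · rw [negDiff_zero, eta, b_cls_eq, cls_head_zero (a := A.hd π) hdπ]
    simp [splitFirst, splitLast, barDiff]
  · have hB := B_cls_rep (π := π) 0
    rw [rep, mul_zero] at hB
    rw [negDiff_succ, eta, eta, map_smul, b_cls_two_smul_sub_hone_rep hdπ hπ, hB]
    simp [Nat.factorial]
  · rw [negDiff_succ, eta, eta, map_smul, map_smul, b_cls_two_smul_sub_hone_rep hdπ hπ,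
      B_cls_two_smul_sub_hone_rep, factorial_div_succ]
    push_cast
    simp only [Pi.zero_apply, pow_succ]
    module

lemma eta_mem_negDeg : A.eta N π ∈ A.negDeg 0 := by
  rw [mem_negDeg]
  rintro (_ | m)
  · exact cls_mem_chainDeg _ _ (by simp [deg])
  · exact Submodule.smul_mem _ _ (cls_mem_chainDeg _ _ (by rw [deg_rep, zero_add, zero_sub]))

theorem isNegCycle_eta (hdπ : A.d N N π = 0)
    (hπ : A.comp (π : A.Hom N N) (π : A.Hom N N) = π) : A.IsNegCycle 0 (A.eta N π) :=
  ⟨eta_mem_negDeg, negDiff_eta hdπ hπ⟩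

lemma oneCycle_zero (x : A.Obj) : A.oneCycle x 0 = A.cls (A.hone x) nil :=
  Pi.single_eq_same (M := fun _ : ℕ => A.NormChain) _ _

lemma oneCycle_succ (x : A.Obj) (m : ℕ) : A.oneCycle x (m + 1) = 0 :=
  Pi.single_eq_of_ne (M := fun _ : ℕ => A.NormChain) m.succ_ne_zero _

theorem isNegCycle_oneCycle (x : A.Obj) : A.IsNegCycle 0 (A.oneCycle x) := by
  refine ⟨mem_negDeg.2 ?_, funext ?_⟩
  · rintro (_ | m)
    · exact cls_mem_chainDeg _ _ (by simp [deg])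
    · exact zero_mem _
  · rintro (_ | _ | m)
    · rw [negDiff_zero, oneCycle_zero, b_cls_hone]
      simp [splitFirst, splitLast, barDiff]
    · rw [negDiff_succ, oneCycle_zero, oneCycle_succ, B_cls_hone, map_zero, add_zero, Pi.zero_apply]
    · rw [negDiff_succ, oneCycle_succ, oneCycle_succ, map_zero, map_zero, add_zero, Pi.zero_apply]

end eta

end complexes

/-- A dg functor: it preserves degrees, differentials, composition and identities. -/
structure DGFunctor (A : DGCategory.{u, v} k G) (A' : DGCategory.{u', v'} k G) where
  obj : A.Obj → A'.Obj
  map : ∀ {x y}, A.Hom x y →ₗ[k] A'.Hom (obj x) (obj y)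
  map_mem : ∀ {x y g} {f : A.Hom x y}, f ∈ A.grade x y g → map f ∈ A'.grade (obj x) (obj y) g
  map_d : ∀ {x y} (f : A.Hom x y), map (A.d x y f) = A'.d (obj x) (obj y) (map f)
  map_comp : ∀ {x y z} (f : A.Hom y z) (f' : A.Hom x y),
    map (A.comp f f') = A'.comp (map f) (map f')
  map_one : ∀ x, map (A.one x) = A'.one (obj x)

namespace DGFunctor

variable {A : DGCategory.{u, v} k G} {A' : DGCategory.{u', v'} k G} (F : DGFunctor A A')

/-- The action of a dg functor on homogeneous morphisms. -/
def hmap {x y : A.Obj} {g : G} (a : A.grade x y g) : A'.grade (F.obj x) (F.obj y) g :=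
  ⟨F.map (a : A.Hom x y), F.map_mem a.2⟩

lemma hmap_hd {x y : A.Obj} {g : G} (a : A.grade x y g) : F.hmap (A.hd a) = A'.hd (F.hmap a) :=
  Subtype.ext (F.map_d _)

lemma hmap_hcomp {x y z : A.Obj} {g h : G} (a : A.grade y z g) (a' : A.grade x y h) :
    F.hmap (A.hcomp a a') = A'.hcomp (F.hmap a) (F.hmap a') :=
  Subtype.ext (F.map_comp _ _)

lemma hmap_hone (x : A.Obj) : F.hmap (A.hone x) = A'.hone (F.obj x) :=
  Subtype.ext (F.map_one x)

lemma isLin_hmap {x y : A.Obj} {g : G} : IsLin (k := k) fun a : A.grade x y g => F.hmap a :=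
  fun c a a' => Subtype.ext (by simp [hmap])

/-- The action of a dg functor on bar words, letter by letter. -/
def mapWord : ∀ {t s : A.Obj}, BarWord A t s → BarWord A' (F.obj t) (F.obj s)
  | _, _, .nil => .nil
  | _, _, .cons a p => .cons (F.hmap a) (mapWord p)

lemma mapWord_append {t y s : A.Obj} (p : BarWord A t y) (q : BarWord A y s) :
    F.mapWord (p.append q) = (F.mapWord p).append (F.mapWord q) := by
  induction p with
  | nil => rfl
  | cons a p ih => simp only [BarWord.cons_append, mapWord, ih]

lemma deg_mapWord {t s : A.Obj} (p : BarWord A t s) : (F.mapWord p).deg = p.deg := by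
  induction p with
  | nil => rfl
  | cons a p ih => simp only [mapWord, BarWord.deg, ih]

lemma mapWord_rep {x : A.Obj} {g : G} (a : A.grade x x g) (n : ℕ) :
    F.mapWord (BarWord.rep a n) = BarWord.rep (F.hmap a) n := by
  induction n with
  | zero => rfl
  | succ n ih => rw [BarWord.rep, mapWord, ih, BarWord.rep]

lemma sumSplits_mapWord {V : Type*} [AddCommGroup V] {t s : A.Obj} (p : BarWord A t s)
    (f : ∀ {y : A'.Obj}, BarWord A' (F.obj t) y → BarWord A' y (F.obj s) → V) :
    (F.mapWord p).sumSplits f = p.sumSplits fun q r => f (F.mapWord q) (F.mapWord r) := by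
  induction p with
  | nil => simp only [mapWord, BarWord.sumSplits_nil]
  | cons a p ih => simp only [mapWord, BarWord.sumSplits_cons, ih]

/-- The map of normalized Hochschild chains induced by a dg functor. -/
noncomputable def chainMap : A.NormChain →ₗ[k] A'.NormChain :=
  A.relSubmodule.liftQ (Finsupp.linearCombination k fun c : HWord A =>
      A'.cls (F.hmap c.head) (F.mapWord c.tail)) <|
    relSubmodule_le_ker (fun a p => A'.cls (F.hmap a) (F.mapWord p))
      (fun p => (isLin_cls_head (F.mapWord p)).comp' F.isLin_hmap)
      (fun a₀ q r => by
        simpa only [mapWord_append, mapWord] using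
          (isLin_cls_tail (F.hmap a₀) (F.mapWord q) (F.mapWord r)).comp' F.isLin_hmap)
      (fun a₀ q r => by
        simpa only [mapWord_append, mapWord, hmap_hone] using
          cls_unit (F.hmap a₀) (F.mapWord q) (F.mapWord r))

lemma chainMap_cls {x y : A.Obj} {g : G} (a₀ : A.grade x y g) (p : BarWord A x y) :
    F.chainMap (A.cls a₀ p) = A'.cls (F.hmap a₀) (F.mapWord p) := by
  simp [chainMap, cls]

lemma chainMap_bHead {x y : A.Obj} {g : G} (a₀ : A.grade x y g) (p : BarWord A x y) :
    F.chainMap (A.bHead a₀ p) = A'.bHead (F.hmap a₀) (F.mapWord p) := by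
  cases p <;> simp only [bHead, mapWord, map_add, map_smul, chainMap_cls, hmap_hd, hmap_hcomp]

lemma chainMap_bPart {x y t : A.Obj} {g : G} (a₀ : A.grade x y g) (q : BarWord A x t)
    (r : BarWord A t y) :
    F.chainMap (A.bPart a₀ q r) = A'.bPart (F.hmap a₀) (F.mapWord q) (F.mapWord r) := by
  rcases r with _ | ⟨a, _ | ⟨a', r⟩⟩
  · simp only [bPart, mapWord, map_zero]
  · simp only [bPart, mapWord, map_sub, map_smul, chainMap_cls, mapWord_append, hmap_hd,
      hmap_hcomp, deg_mapWord]
  · simp only [bPart, mapWord, map_add, map_smul, chainMap_cls, mapWord_append, hmap_hd,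
      hmap_hcomp, deg_mapWord]

lemma chainMap_b (z : A.NormChain) : F.chainMap (A.b z) = A'.b (F.chainMap z) := by
  suffices F.chainMap ∘ₗ A.b = A'.b ∘ₗ F.chainMap from LinearMap.congr_fun this z
  refine linearMap_ext_cls fun a₀ p => ?_
  have hsum := F.sumSplits_mapWord p fun q r => A'.bPart (F.hmap a₀) q r
  simp only [← chainMap_bPart, ← BarWord.sumSplits_map] at hsum
  simp only [LinearMap.comp_apply, b_cls, chainMap_cls, bWord, map_add, chainMap_bHead]
  exact congrArg _ hsum.symm

lemma chainMap_B (z : A.NormChain) : F.chainMap (A.B z) = A'.B (F.chainMap z) := by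
  suffices F.chainMap ∘ₗ A.B = A'.B ∘ₗ F.chainMap from LinearMap.congr_fun this z
  refine linearMap_ext_cls fun a₀ p => ?_
  simp only [LinearMap.comp_apply, B_cls_eq, chainMap_cls, BarWord.sumSplits_map,
    sumSplits_mapWord, map_smul, mapWord_append, mapWord, hmap_hone, deg_mapWord]

lemma chainMap_mem_chainDeg {g : G} {z : A.NormChain} (hz : z ∈ A.chainDeg g) :
    F.chainMap z ∈ A'.chainDeg g := by
  rw [← add_zero g]
  refine map_mem_chainDeg (fun a₀ p => ?_) hz
  rw [chainMap_cls]
  exact cls_mem_chainDeg _ _ (by rw [deg_mapWord, add_zero])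

/-- The map of negative cyclic complexes induced by a dg functor. -/
noncomputable def negMap : A.NegChain →ₗ[k] A'.NegChain := F.chainMap.compLeft ℕ

lemma negMap_apply (z : A.NegChain) (m : ℕ) : F.negMap z m = F.chainMap (z m) := rfl

lemma negMap_mem_negDeg {g : G} {z : A.NegChain} (hz : z ∈ A.negDeg g) :
    F.negMap z ∈ A'.negDeg g :=
  mem_negDeg.2 fun m => F.chainMap_mem_chainDeg (mem_negDeg.1 hz m)

lemma negMap_negDiff (z : A.NegChain) : F.negMap (A.negDiff z) = A'.negDiff (F.negMap z) := by
  funext m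
  cases m with
  | zero => simp only [negMap_apply, negDiff_zero, chainMap_b]
  | succ m => simp only [negMap_apply, negDiff_succ, map_add, chainMap_b, chainMap_B]

lemma negHomologous_negMap {g : G} {z z' : A.NegChain} (h : A.NegHomologous g z z') :
    A'.NegHomologous g (F.negMap z) (F.negMap z') := by
  obtain ⟨w, hw, hwz⟩ := h
  exact ⟨F.negMap w, F.negMap_mem_negDeg hw, by rw [← negMap_negDiff, hwz, map_sub]⟩

lemma negMap_oneCycle (x : A.Obj) : F.negMap (A.oneCycle x) = A'.oneCycle (F.obj x) := by
  funext m
  cases m with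
  | zero => rw [negMap_apply, oneCycle_zero, oneCycle_zero, chainMap_cls, hmap_hone, mapWord]
  | succ m => rw [negMap_apply, oneCycle_succ, oneCycle_succ, map_zero]

lemma negMap_eta (N : A.Obj) (π : A.grade N N (0 : G)) :
    F.negMap (A.eta N π) = A'.eta (F.obj N) (F.hmap π) := by
  funext m
  cases m with
  | zero => exact F.chainMap_cls _ _
  | succ m =>
    have hε : F.hmap ((2 : k) • π - A.hone N) = (2 : k) • F.hmap π - A'.hone (F.obj N) := by
      rw [F.isLin_hmap.map_sub, F.isLin_hmap.map_smul, hmap_hone]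
    rw [negMap_apply, eta, eta, map_smul, chainMap_cls, mapWord_rep, hε]

end DGFunctor

section pullback

variable (A : DGCategory.{u, v} k G) {I : Type u'} (f : I → A.Obj)

/-- The dg category on `I` whose morphisms `x → y` are the morphisms `f x → f y` of `A`. It
separates objects that `f` identifies. -/
def pullback : DGCategory.{u', v} k G where
  Obj := I
  Hom x y := A.Hom (f x) (f y)
  grade x y := A.grade (f x) (f y)
  grade_isInternal x y := A.grade_isInternal (f x) (f y)
  d x y := A.d (f x) (f y)
  comp := A.comp
  one x := A.one (f x)
  comp_assoc := A.comp_assoc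
  one_comp := A.one_comp
  comp_one := A.comp_one
  one_mem x := A.one_mem (f x)
  comp_mem := A.comp_mem
  d_mem := A.d_mem
  d_d := A.d_d
  d_comp := A.d_comp

/-- The fully faithful dg functor from a pullback. -/
def fromPullback : DGFunctor (A.pullback f) A where
  obj := f
  map {x y} := (LinearMap.id : A.Hom (f x) (f y) →ₗ[k] A.Hom (f x) (f y))
  map_mem h := h
  map_d _ := rfl
  map_comp _ _ := rfl
  map_one _ := rfl

end pullback

/-- A presentation of `P` as a direct summand of `N` by closed morphisms of degree `0`. -/
structure DirectSummand (A : DGCategory.{u, v} k G) (P N : A.Obj) where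
  incl : A.grade P N (0 : G)
  proj : A.grade N P (0 : G)
  d_incl : A.d P N incl = 0
  d_proj : A.d N P proj = 0
  proj_comp_incl : A.comp (proj : A.Hom N P) (incl : A.Hom P N) = A.one P

namespace DirectSummand

variable {A : DGCategory.{u, v} k G} {P N : A.Obj} (R : DirectSummand A P N)

/-- The idempotent endomorphism of `N` with image `P`. -/
def idem : A.grade N N (0 : G) :=
  ⟨A.comp (R.incl : A.Hom P N) (R.proj : A.Hom N P), A.comp_mem_zero R.incl.2 R.proj.2⟩

lemma d_idem : A.d N N R.idem = 0 := by
  simp [idem, A.d_comp R.incl.2, R.d_incl, R.d_proj]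

lemma idem_comp_incl : A.comp (R.idem : A.Hom N N) (R.incl : A.Hom P N) = R.incl := by
  rw [idem, A.comp_assoc, R.proj_comp_incl, A.comp_one]

lemma proj_comp_idem : A.comp (R.proj : A.Hom N P) (R.idem : A.Hom N N) = R.proj := by
  rw [idem, ← A.comp_assoc, R.proj_comp_incl, A.one_comp]

lemma idem_comp_idem : A.comp (R.idem : A.Hom N N) (R.idem : A.Hom N N) = R.idem := by
  nth_rw 2 [idem]
  rw [← A.comp_assoc, R.idem_comp_incl, idem]

lemma b_cls_proj_cons_incl : A.b (A.cls R.proj (.cons R.incl .nil))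
    = A.cls (A.hone P) .nil - A.cls R.idem .nil := by
  have hproj : A.cls (A.hd R.proj) (.cons R.incl .nil) = 0 := cls_head_zero R.d_proj _
  have hincl : A.cls R.proj (.cons (A.hd R.incl) .nil) = 0 :=
    cls_tail_zero R.proj R.d_incl .nil .nil
  have hP : A.cls (A.hcomp R.proj R.incl) .nil = A.cls (A.hone P) .nil :=
    cls_congr (add_zero 0) R.proj_comp_incl _
  have hN : A.cls (A.hcomp R.incl R.proj) .nil = A.cls R.idem .nil :=
    cls_congr (add_zero 0) rfl _
  rw [b_cls_eq]
  simp [BarWord.barDiff, BarWord.splitFirst, BarWord.splitLast, hproj, hincl, hP, hN,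
    par_zero, sgn_zero, BarWord.par_deg_nil]

section diagonalSummand

variable {R} {ι : Type*} [Fintype ι] {D : IdentityDecomposition A ι}

lemma isDiagonal_idem_of_incl_proj (hi : D.IsDiagonal R.incl) (hp : D.IsDiagonal R.proj) :
    D.IsDiagonal R.idem := by
  simpa [IdentityDecomposition.IsDiagonal, hcomp, idem] using hi.hcomp hp

lemma eta_succ_mem_diagonalChains {N : A.Obj} {π : A.grade N N (0 : G)} (hπ : D.IsDiagonal π)
    (m : ℕ) : A.eta N π (m + 1) ∈ D.diagonalChains := by
  have hrep (n : ℕ) : D.IsDiagonalWord (BarWord.rep π n) := by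
    induction n with
    | zero => trivial
    | succ n ih => exact ⟨hπ, ih⟩
  exact Submodule.smul_mem _ _ <| IdentityDecomposition.cls_mem_diagonalChains
    ((hπ.smul 2).sub (IdentityDecomposition.isDiagonal_hone N)) (hrep (2 * m + 1 + 1))

theorem negHomologous_oneCycle_eta_of_isDiagonal (hincl : ∀ x i, D.IsDiagonal (D.incl x i))
    (hproj : ∀ x i, D.IsDiagonal (D.proj x i)) (hi : D.IsDiagonal R.incl)
    (hp : D.IsDiagonal R.proj) : A.NegHomologous 0 (A.oneCycle P) (A.eta N R.idem) := by
  set w₀ := A.cls R.proj (.cons R.incl .nil)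
  set ζ := A.oneCycle P - A.eta N R.idem
  have ζ_apply (m : ℕ) : ζ m = A.oneCycle P m - A.eta N R.idem m := rfl
  have hP := isNegCycle_oneCycle P
  have hη := isNegCycle_eta R.d_idem R.idem_comp_idem
  have hζ : A.negDiff ζ = 0 := by rw [map_sub, hP.2, hη.2, sub_zero]
  have hζS (m : ℕ) : ζ (m + 1) ∈ D.diagonalChains := by
    rw [ζ_apply, oneCycle_succ, zero_sub]
    exact neg_mem (eta_succ_mem_diagonalChains (isDiagonal_idem_of_incl_proj hi hp) m)
  have hw₀ : A.b w₀ = ζ 0 := by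
    rw [R.b_cls_proj_cons_incl, ζ_apply, oneCycle_zero, eta]
  have hw₀S : w₀ ∈ D.diagonalChains :=
    IdentityDecomposition.cls_mem_diagonalChains hp ⟨hi, trivial⟩
  exact ⟨liftAlong D.contraction ζ w₀,
    liftAlong_mem_negDeg D.contraction_mem_chainDeg (sub_mem hP.1 hη.1)
      (cls_mem_chainDeg _ _ (by simp [BarWord.deg])),
    negDiff_liftAlong (fun _ => IdentityDecomposition.B_mem_diagonalChains)
      (fun _ => IdentityDecomposition.contraction_mem_diagonalChains hincl hproj)
      (fun _ => IdentityDecomposition.b_contraction_add_of_mem) hζ hζS hw₀S hw₀⟩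

end diagonalSummand

/-- The idempotent complementary to `idem`. -/
def compl : A.grade N N (0 : G) := A.hone N - R.idem

lemma d_compl : A.d N N R.compl = 0 := by
  simp [compl, hone, A.d_one, R.d_idem]

lemma compl_comp_incl : A.comp (R.compl : A.Hom N N) (R.incl : A.Hom P N) = 0 := by
  simp [compl, hone, A.one_comp, R.idem_comp_incl]

lemma proj_comp_compl : A.comp (R.proj : A.Hom N P) (R.compl : A.Hom N N) = 0 := by
  simp [compl, hone, A.comp_one, R.proj_comp_idem]

lemma compl_comp_compl : A.comp (R.compl : A.Hom N N) (R.compl : A.Hom N N) = R.compl := by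
  simp [compl, hone, A.one_comp, A.comp_one, R.idem_comp_idem]

lemma idem_add_compl : (R.idem : A.Hom N N) + (R.compl : A.Hom N N) = A.one N := by
  simp [compl, hone]

/-- The inclusions of the summands of `P` (`true`) and `N` (`false`): the summand `true` is `P`,
the summand `false` is cut out of `N` by `compl` and does not occur in `P`. -/
def summandIncl : ∀ x m : Bool, A.grade (cond m P N) (cond x P N) (0 : G)
  | true, true => A.hone P
  | true, false => (0 : A.grade N P (0 : G))
  | false, true => R.incl
  | false, false => R.compl

/-- The projections onto the summands of `summandIncl`. -/
def summandProj : ∀ x m : Bool, A.grade (cond x P N) (cond m P N) (0 : G)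
  | true, true => A.hone P
  | true, false => (0 : A.grade P N (0 : G))
  | false, true => R.proj
  | false, false => R.compl

lemma d_summandIncl : ∀ x m : Bool, A.d (cond m P N) (cond x P N) (R.summandIncl x m) = 0
  | true, true => A.d_one P
  | true, false => (A.d N P).map_zero
  | false, true => R.d_incl
  | false, false => R.d_compl

lemma d_summandProj : ∀ x m : Bool, A.d (cond x P N) (cond m P N) (R.summandProj x m) = 0
  | true, true => A.d_one P
  | true, false => (A.d P N).map_zero
  | false, true => R.d_proj
  | false, false => R.d_compl

lemma sum_summandIncl_comp_summandProj : ∀ x : Bool,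
    ∑ m, A.comp (R.summandIncl x m : A.Hom (cond m P N) (cond x P N))
      (R.summandProj x m : A.Hom (cond x P N) (cond m P N)) = A.one (cond x P N)
  | true => by simp [summandIncl, summandProj, hone, A.one_comp]
  | false => by
    simp only [Fintype.sum_bool, summandIncl, summandProj]
    exact (congrArg _ R.compl_comp_compl).trans R.idem_add_compl

variable (P N) in
/-- The dg category with two distinct objects `true` and `false`, which stand for `P` and `N`. -/
abbrev twoObjects : DGCategory.{0, v} k G := A.pullback fun x : Bool => cond x P N

/-- The identity of `P` is kept, and that of `N` is decomposed as
`incl ∘ proj + compl ∘ compl`. -/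
def identityDecomposition : IdentityDecomposition (twoObjects P N) Bool where
  mid := id
  incl := R.summandIncl
  proj := R.summandProj
  d_incl := R.d_summandIncl
  d_proj := R.d_summandProj
  sum_incl_proj := R.sum_summandIncl_comp_summandProj

lemma isDiagonal_of_comp {x y : Bool} {a : A.grade (cond x P N) (cond y P N) (0 : G)}
    (c : Bool → k)
    (h : ∀ m, A.comp (a : A.Hom (cond x P N) (cond y P N)) (R.summandIncl x m : A.Hom _ _)
        = c m • (R.summandIncl y m : A.Hom (cond m P N) (cond y P N)) ∧
      A.comp (R.summandProj y m : A.Hom (cond y P N) (cond m P N)) (a : A.Hom _ _)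
        = c m • (R.summandProj x m : A.Hom (cond x P N) (cond m P N))) :
    R.identityDecomposition.IsDiagonal (x := x) (y := y) a :=
  ⟨rfl, c, h⟩

lemma isDiagonal_incl : R.identityDecomposition.IsDiagonal (x := true) (y := false) R.incl :=
  R.isDiagonal_of_comp (fun m => cond m 1 0) fun
    | true => by simp [summandIncl, summandProj, hone, A.comp_one, R.proj_comp_incl]
    | false => by simp [summandIncl, summandProj, R.compl_comp_incl]

lemma isDiagonal_proj : R.identityDecomposition.IsDiagonal (x := false) (y := true) R.proj :=
  R.isDiagonal_of_comp (fun m => cond m 1 0) fun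
    | true => by simp [summandIncl, summandProj, hone, A.one_comp, R.proj_comp_incl]
    | false => by simp [summandIncl, summandProj, R.proj_comp_compl]

lemma isDiagonal_compl :
    R.identityDecomposition.IsDiagonal (x := false) (y := false) R.compl :=
  R.isDiagonal_of_comp (fun m => cond m 0 1) fun
    | true => by simp [summandIncl, summandProj, R.compl_comp_incl, R.proj_comp_compl]
    | false => by simp [summandIncl, summandProj, R.compl_comp_compl]

lemma isDiagonal_summandIncl (x m : Bool) :
    R.identityDecomposition.IsDiagonal (R.identityDecomposition.incl x m) := by
  rcases x with _ | _ <;> rcases m with _ | _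
  · exact R.isDiagonal_compl
  · exact R.isDiagonal_incl
  · exact R.isDiagonal_of_comp (x := false) (y := true) (a := (0 : A.grade N P (0 : G))) 0
      fun m => by simp
  · exact IdentityDecomposition.isDiagonal_hone (A := twoObjects P N) true

lemma isDiagonal_summandProj (x m : Bool) :
    R.identityDecomposition.IsDiagonal (R.identityDecomposition.proj x m) := by
  rcases x with _ | _ <;> rcases m with _ | _
  · exact R.isDiagonal_compl
  · exact R.isDiagonal_proj
  · exact R.isDiagonal_of_comp (x := true) (y := false) (a := (0 : A.grade P N (0 : G))) 0
      fun m => by simp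
  · exact IdentityDecomposition.isDiagonal_hone (A := twoObjects P N) true

/-- The direct summand `P` of `N`, seen in the category with two objects. -/
def toTwoObjects : DirectSummand (twoObjects P N) true false where
  incl := R.incl
  proj := R.proj
  d_incl := R.d_incl
  d_proj := R.d_proj
  proj_comp_incl := R.proj_comp_incl

theorem negHomologous_oneCycle_eta : A.NegHomologous 0 (A.oneCycle P) (A.eta N R.idem) := by
  have h := R.toTwoObjects.negHomologous_oneCycle_eta_of_isDiagonal R.isDiagonal_summandIncl
    R.isDiagonal_summandProj R.isDiagonal_incl R.isDiagonal_proj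
  let F : DGFunctor (twoObjects P N) A := A.fromPullback _
  have h' := F.negHomologous_negMap h
  rw [F.negMap_oneCycle true, F.negMap_eta false R.toTwoObjects.idem] at h'
  exact h'

end DirectSummand

end DGCategory

theorem mainTheorem4_general {k : Type w'} [CommRing k] {G : Type w} [AddCommGroupWithOne G]
    [GradingParity G] (A : DGCategory.{u, v} k G) (P N : A.Obj)
    (i : A.Hom P N) (j : A.Hom N P)
    (hi : i ∈ A.grade P N 0) (hj : j ∈ A.grade N P 0)
    (hdi : A.d P N i = 0) (hdj : A.d N P j = 0)
    (hji : A.comp j i = A.one P) :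
    letI π : A.grade N N 0 := ⟨A.comp i j, A.comp_mem_zero hi hj⟩
    A.IsNegCycle 0 (A.oneCycle P) ∧
    A.IsNegCycle 0 (A.eta N π) ∧
    A.NegHomologous 0 (A.oneCycle P) (A.eta N π) :=
  let R : A.DirectSummand P N := ⟨⟨i, hi⟩, ⟨j, hj⟩, hdi, hdj, hji⟩
  ⟨DGCategory.isNegCycle_oneCycle P, DGCategory.isNegCycle_eta R.d_idem R.idem_comp_idem,
    R.negHomologous_oneCycle_eta⟩

theorem mainTheorem4 {k : Type w'} [Field k] {G : Type w} [AddCommGroupWithOne G]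
    [GradingParity G] (A : DGCategory.{u, v} k G) (P N : A.Obj)
    (i : A.Hom P N) (j : A.Hom N P)
    (hi : i ∈ A.grade P N 0) (hj : j ∈ A.grade N P 0)
    (hdi : A.d P N i = 0) (hdj : A.d N P j = 0)
    (hji : A.comp j i = A.one P) :
    letI C := A.full {P, N}
    letI P' : C.Obj := ⟨P, Or.inl rfl⟩
    letI N' : C.Obj := ⟨N, Or.inr rfl⟩
    letI π : C.grade N' N' 0 := ⟨A.comp i j, A.comp_mem_zero hi hj⟩
    C.IsNegCycle 0 (C.oneCycle P') ∧
    C.IsNegCycle 0 (C.eta N' π) ∧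
    C.NegHomologous 0 (C.oneCycle P') (C.eta N' π) :=
  mainTheorem4_general (A.full {P, N}) ⟨P, Or.inl rfl⟩ ⟨N, Or.inr rfl⟩ i j hi hj hdi hdj hji
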